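/- Let $K$ be a field and let $G$ be a finite simple graph with vertex set $V$, $|V|=n$, and edge set $E(G)$, $|E(G)|=m$. Assume that $G$ is gap-free: for any two edges $\{v_1,v_2\},\{w_1,w_2\}\in E(G)$ with $v_1,v_2,w_1,w_2$ pairwise distinct there are $i,j\in\{1,2\}$ with $\{v_i,w_j\}\in E(G)$. For an edge $e=\{v,w\}$ let $M_e=x_vx_w\in K[x_v: v\in V]$ be its edge monomial. Let $\sigma$ be any graded reverse lexicographic order on $K[x_v: v\in V]$ (for an arbitrary ordering of the variables), and number the edges of $G$ as $e_1,\dots,e_m$ so that $M_{e_1}\succ_\sigma M_{e_2}\succ_\sigma\dots\succ_\sigma M_{e_m}$. Let $I_G$ be the toric ideal of $G$, that is, the kernel of the $K$-algebra homomorphism $K[y_1,\dots,y_m]\to K[x_v: v\in V]$, $y_i\mapsto M_{e_i}$, and let $\tau$ be the lexicographic order on $K[y_1,\dots,y_m]$ with $y_1\succ_\tau y_2\succ_\tau\dots\succ_\tau y_m$. Then: 1. the initial ideal $\mathrm{in}_\tau(I_G)$ is generated by squarefree monomials; 2. $I_G$ has a unique reduced Gröbner basis with respect to $\tau$, and every element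 of it is a circuit of $I_G$, that is, an irreducible binomial $b=u-v\in I_G$ (with $u\neq v$ monomials) such that no nonzero binomial $b'=u'-v'\in I_G$ (with $u',v'$ monomials) satisfies $\mathrm{supp}(b')\subsetneq\mathrm{supp}(b)$, where $\mathrm{supp}$ denotes the set of variables that appear in a binomial. Here a reduced Gröbner basis of an ideal $I$ is a finite set of monic elements of $I$ whose leading terms minimally generate $\mathrm{in}_\tau(I)$ and such that no trailing term of an element of it lies in $\mathrm{in}_\tau(I)$. -/

import Mathlib

open scoped MonomialOrder

namespace GapFree

/-- A graph is gap-free if any two edges `{v₁, v₂}`, `{w₁, w₂}` without common vertices are linked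
by an edge `{vᵢ, wⱼ}`. -/
def IsGapFree {V : Type*} (G : SimpleGraph V) : Prop :=
  ∀ v₁ v₂ w₁ w₂ : V, G.Adj v₁ v₂ → G.Adj w₁ w₂ →
    v₁ ≠ w₁ → v₁ ≠ w₂ → v₂ ≠ w₁ → v₂ ≠ w₂ →
    G.Adj v₁ w₁ ∨ G.Adj v₁ w₂ ∨ G.Adj v₂ w₁ ∨ G.Adj v₂ w₂

/-- The strict graded reverse lexicographic order on exponent vectors, for the order of the
variables in which `x_v` is larger than `x_w` when `v < w`: first compare total degrees; for equal
total degrees, `a` is smaller than `b` if, at the largest index `i` (that is, the smallest variable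
`x_i`) where they differ, `a` has the larger exponent. -/
def GrevlexLT {V : Type*} [LinearOrder V] (a b : V →₀ ℕ) : Prop :=
  a.degree < b.degree ∨
    (a.degree = b.degree ∧ ∃ i : V, b i < a i ∧ ∀ j : V, i < j → a j = b j)

/-- The exponent vector of the edge monomial `x_i x_j` of `{i, j}`. -/
noncomputable def edgeExponent {V : Type*} (e : Sym2 V) : V →₀ ℕ :=
  Sym2.lift ⟨fun i j => Finsupp.single i 1 + Finsupp.single j 1, fun _ _ => add_comm _ _⟩ e

/-- The edge monomial `M_e`. -/
noncomputable def edgeMonomial (K : Type*) [Field K] {V : Type*} (e : Sym2 V) : MvPolynomial V K :=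
  MvPolynomial.monomial (edgeExponent e) 1

/-- The toric ideal `I_G` of a graph with edges `e 0, …, e (m - 1)`: the kernel of the
`K`-algebra map `K[y_0, …, y_{m-1}] → K[x_v : v ∈ V]`, `y_i ↦ M_{e i}`, whose image is the edge
ring `K[G]`. -/
noncomputable def toricIdeal (K : Type*) [Field K] {V : Type*} {G : SimpleGraph V} {m : ℕ}
    (e : Fin m ≃ G.edgeSet) : Ideal (MvPolynomial (Fin m) K) :=
  RingHom.ker (MvPolynomial.aeval (fun i : Fin m => edgeMonomial K (e i : Sym2 V)) :
    MvPolynomial (Fin m) K →ₐ[K] MvPolynomial V K)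

/-- The initial ideal `in_τ(I)`, generated by the leading terms of the elements of `I`. -/
noncomputable def initialIdeal {K : Type*} [Field K] {ι : Type*} (τ : MonomialOrder ι)
    (I : Ideal (MvPolynomial ι K)) : Ideal (MvPolynomial ι K) :=
  Ideal.span (τ.leadingTerm '' (I : Set (MvPolynomial ι K)))

/-- Squarefree monomials: products of distinct variables. -/
def IsSquarefreeMonomial {K : Type*} [Field K] {ι : Type*} (p : MvPolynomial ι K) : Prop :=
  ∃ a : ι →₀ ℕ, (∀ i, a i ≤ 1) ∧ p = MvPolynomial.monomial a 1

/-- `𝒢` is a reduced Gröbner basis of `I` with respect to `τ`. -/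
structure IsReducedGroebnerBasis {K : Type*} [Field K] {ι : Type*} (τ : MonomialOrder ι)
    (I : Ideal (MvPolynomial ι K)) (𝒢 : Set (MvPolynomial ι K)) : Prop where
  finite : 𝒢.Finite
  subset : 𝒢 ⊆ (I : Set (MvPolynomial ι K))
  monic : ∀ g ∈ 𝒢, τ.Monic g
  /-- the leading terms generate the initial ideal -/
  span_leadingTerm : Ideal.span (τ.leadingTerm '' 𝒢) = initialIdeal τ I
  /-- and no leading term can be left out -/
  minimal : ∀ g ∈ 𝒢, τ.leadingTerm g ∉ Ideal.span (τ.leadingTerm '' (𝒢 \ {g}))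
  /-- no trailing term lies in the initial ideal -/
  trailing : ∀ g ∈ 𝒢, ∀ a ∈ g.support, a ≠ τ.degree g →
    MvPolynomial.monomial a (1 : K) ∉ initialIdeal τ I

/-- A (nonzero) binomial is a difference `u - v` of two distinct monomials. -/
def IsBinomial {K : Type*} [Field K] {ι : Type*} (b : MvPolynomial ι K) : Prop :=
  ∃ u v : ι →₀ ℕ, u ≠ v ∧ b = MvPolynomial.monomial u 1 - MvPolynomial.monomial v 1

/-- A circuit of `I`: an irreducible binomial in `I` of minimal support, where the support of a
binomial is the set of variables that appear in it. -/
def IsCircuit {K : Type*} [Field K] {ι : Type*} (I : Ideal (MvPolynomial ι K))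
    (b : MvPolynomial ι K) : Prop :=
  IsBinomial b ∧ b ∈ I ∧ Irreducible b ∧
    ∀ b' : MvPolynomial ι K, IsBinomial b' → b' ∈ I → ¬ b'.vars ⊂ b.vars

end GapFree

namespace GapFree

open MvPolynomial

/-! ### Reduced Gröbner bases of toric ideals. -/

section Toric

variable {K : Type*} [Field K] {ι σ : Type*}

theorem aeval_monomial_monomial (p : ι → σ →₀ ℕ) (a : ι →₀ ℕ) (c : K) :
    aeval (fun i => monomial (p i) (1 : K)) (monomial a c) =
      monomial (Finsupp.linearCombination ℕ p a) c := by
  rw [aeval_monomial, Finsupp.linearCombination_apply, Finsupp.prod, Finsupp.sum]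
  simp only [monomial_pow, one_pow]
  rw [monomial_sum_index, algebraMap_eq]

/-- The toric ideal of the monomials with exponents `p i`. -/
noncomputable def expKer (K : Type*) [Field K] (p : ι → σ →₀ ℕ) : Ideal (MvPolynomial ι K) :=
  RingHom.ker (aeval (fun i => monomial (p i) (1 : K)) : MvPolynomial ι K →ₐ[K] MvPolynomial σ K)

theorem monomial_sub_monomial_mem_expKer {p : ι → σ →₀ ℕ} {u v : ι →₀ ℕ} :
    (monomial u 1 - monomial v 1 : MvPolynomial ι K) ∈ expKer K p ↔
      Finsupp.linearCombination ℕ p u = Finsupp.linearCombination ℕ p v := by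
  rw [expKer, RingHom.mem_ker, map_sub, aeval_monomial_monomial, aeval_monomial_monomial,
    sub_eq_zero, monomial_left_inj one_ne_zero]

/-- The exponents of the monomials that are not the smallest of their fiber. -/
def nonstandard (τ : MonomialOrder ι) (p : ι → σ →₀ ℕ) : Set (ι →₀ ℕ) :=
  {u | ∃ v, v ≺[τ] u ∧ Finsupp.linearCombination ℕ p v = Finsupp.linearCombination ℕ p u}

variable {τ : MonomialOrder ι} {p : ι → σ →₀ ℕ}

theorem isUpperSet_nonstandard : IsUpperSet (nonstandard τ p) := by
  rintro a b hab ⟨v, hv, h⟩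
  obtain ⟨c, rfl⟩ := exists_add_of_le hab
  exact ⟨v + c, by simpa using hv, by simp [h]⟩

theorem exists_notMem_nonstandard (u : ι →₀ ℕ) : ∃ v, v ∉ nonstandard τ p ∧
    Finsupp.linearCombination ℕ p v = Finsupp.linearCombination ℕ p u := by
  have wf : WellFounded fun a b : ι →₀ ℕ => a ≺[τ] b := InvImage.wf τ.toSyn wellFounded_lt
  let S : Set (ι →₀ ℕ) :=
    {v | Finsupp.linearCombination ℕ p v = Finsupp.linearCombination ℕ p u}
  obtain ⟨v, hv, hmin⟩ := wf.has_min S ⟨u, rfl⟩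
  refine ⟨v, ?_, hv⟩
  rintro ⟨x, hx, hxv⟩
  exact hmin x (hxv.trans hv) hx

theorem lt_of_notMem_nonstandard {u v : ι →₀ ℕ} (hu : u ∈ nonstandard τ p)
    (hv : v ∉ nonstandard τ p)
    (h : Finsupp.linearCombination ℕ p v = Finsupp.linearCombination ℕ p u) : v ≺[τ] u := by
  rcases lt_trichotomy (τ.toSyn v) (τ.toSyn u) with h1 | h1 | h1
  · exact h1
  · exact absurd (τ.toSyn.injective h1 ▸ hu) hv
  · exact absurd ⟨u, h1, h.symm⟩ hv

/-- If the leading exponent were the smallest of its fiber, no other term of `f` would have the same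
image, so the image of the leading term could not cancel. -/
theorem degree_mem_nonstandard {f : MvPolynomial ι K} (hf : f ∈ expKer K p) (h0 : f ≠ 0) :
    τ.degree f ∈ nonstandard τ p := by
  classical
  by_contra hn
  rw [expKer, RingHom.mem_ker, f.as_sum, map_sum] at hf
  simp only [aeval_monomial_monomial] at hf
  have := congrArg (coeff (Finsupp.linearCombination ℕ p (τ.degree f))) hf
  rw [coeff_sum, Finset.sum_eq_single (τ.degree f)] at this
  · simp [h0] at this
  · intro b hb hne
    rw [coeff_monomial, if_neg]
    intro h
    refine hn ⟨b, lt_of_le_of_ne (τ.le_degree hb) fun h => hne (τ.toSyn.injective h), h⟩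
  · intro h
    exact absurd (τ.degree_mem_support h0) h

theorem degree_monomial_sub_monomial {u v : ι →₀ ℕ} (h : v ≺[τ] u) :
    τ.degree (monomial u 1 - monomial v 1 : MvPolynomial ι K) = u := by
  classical
  rw [τ.degree_sub_of_lt] <;> simp [MonomialOrder.degree_monomial, h]

theorem monic_monomial_sub_monomial {u v : ι →₀ ℕ} (h : v ≺[τ] u) :
    τ.Monic (monomial u 1 - monomial v 1 : MvPolynomial ι K) := by
  classical
  rw [MonomialOrder.Monic, τ.leadingCoeff_sub_of_lt] <;> simp [MonomialOrder.degree_monomial, h]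

theorem initialIdeal_expKer : initialIdeal τ (expKer K p) =
    Ideal.span ((fun a => monomial a (1 : K)) '' nonstandard τ p) := by
  apply le_antisymm
  · refine Ideal.span_le.2 ?_
    rintro _ ⟨f, hf, rfl⟩
    by_cases h0 : f = 0
    · simp [h0]
    · rw [MonomialOrder.leadingTerm, ← mul_one (τ.leadingCoeff f), ← C_mul_monomial]
      exact Ideal.mul_mem_left _ _
        (Ideal.subset_span ⟨_, degree_mem_nonstandard hf h0, rfl⟩)
  · refine Ideal.span_mono ?_
    rintro _ ⟨u, ⟨v, hv, h⟩, rfl⟩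
    refine ⟨monomial u 1 - monomial v 1, monomial_sub_monomial_mem_expKer.2 h.symm, ?_⟩
    rw [MonomialOrder.leadingTerm, degree_monomial_sub_monomial hv,
      (monic_monomial_sub_monomial hv).leadingCoeff_eq_one]

theorem monomial_mem_initialIdeal {a : ι →₀ ℕ} :
    monomial a (1 : K) ∈ initialIdeal τ (expKer K p) ↔ a ∈ nonstandard τ p := by
  classical
  rw [initialIdeal_expKer, mem_ideal_span_monomial_image]
  simp only [support_monomial, one_ne_zero, if_false, Finset.mem_singleton, forall_eq]
  exact ⟨fun ⟨s, hs, h⟩ => isUpperSet_nonstandard h hs, fun h => ⟨a, h, le_rfl⟩⟩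

theorem exists_minimal_nonstandard_le {u : ι →₀ ℕ} (hu : u ∈ nonstandard τ p) :
    ∃ a ≤ u, Minimal (· ∈ nonstandard τ p) a :=
  exists_minimal_le_of_wellFoundedLT _ _ hu

/-- The binomials `x^u - x^v` with `u` a minimal generator of the initial ideal and `v` the smallest
exponent in the fiber of `u`. -/
def reducedBinomials (K : Type*) [Field K] (τ : MonomialOrder ι) (p : ι → σ →₀ ℕ) :
    Set (MvPolynomial ι K) :=
  {b | ∃ u v, Minimal (· ∈ nonstandard τ p) u ∧ v ∉ nonstandard τ p ∧
    Finsupp.linearCombination ℕ p v = Finsupp.linearCombination ℕ p u ∧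
    b = monomial u 1 - monomial v 1}

theorem leadingTerm_monomial_sub_monomial {u v : ι →₀ ℕ} (h : v ≺[τ] u) :
    τ.leadingTerm (monomial u 1 - monomial v 1 : MvPolynomial ι K) = monomial u 1 := by
  rw [MonomialOrder.leadingTerm, degree_monomial_sub_monomial h,
    (monic_monomial_sub_monomial h).leadingCoeff_eq_one]

theorem leadingTerm_image_reducedBinomials : τ.leadingTerm '' reducedBinomials K τ p =
    (fun a => monomial a (1 : K)) '' {u | Minimal (· ∈ nonstandard τ p) u} := by
  ext f
  constructor
  · rintro ⟨_, ⟨u, v, hu, hv, h, rfl⟩, rfl⟩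
    exact ⟨u, hu, (leadingTerm_monomial_sub_monomial (lt_of_notMem_nonstandard hu.1 hv h)).symm⟩
  · rintro ⟨u, hu, rfl⟩
    obtain ⟨v, hv, h⟩ := exists_notMem_nonstandard (τ := τ) (p := p) u
    exact ⟨_, ⟨u, v, hu, hv, h, rfl⟩,
      leadingTerm_monomial_sub_monomial (lt_of_notMem_nonstandard hu.1 hv h)⟩

theorem initialIdeal_expKer_eq_span_minimal : initialIdeal τ (expKer K p) =
    Ideal.span ((fun a => monomial a (1 : K)) '' {u | Minimal (· ∈ nonstandard τ p) u}) := by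
  rw [initialIdeal_expKer]
  apply le_antisymm
  · refine Ideal.span_le.2 ?_
    rintro _ ⟨u, hu, rfl⟩
    obtain ⟨a, ha, hmin⟩ := exists_minimal_nonstandard_le hu
    classical
    simp only [SetLike.mem_coe, mem_ideal_span_monomial_image, support_monomial, one_ne_zero,
      if_false, Finset.mem_singleton, forall_eq]
    exact ⟨a, hmin, ha⟩
  · exact Ideal.span_mono (Set.image_mono fun u hu => hu.1)

/-- The smallest exponent of a fiber is unique. -/
theorem eq_of_notMem_nonstandard {v w : ι →₀ ℕ} (hv : v ∉ nonstandard τ p)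
    (hw : w ∉ nonstandard τ p)
    (h : Finsupp.linearCombination ℕ p v = Finsupp.linearCombination ℕ p w) : v = w := by
  rcases lt_trichotomy (τ.toSyn v) (τ.toSyn w) with h1 | h1 | h1
  · exact absurd ⟨v, h1, h⟩ hw
  · exact τ.toSyn.injective h1
  · exact absurd ⟨w, h1, h.symm⟩ hv

theorem finite_reducedBinomials [Finite ι] : (reducedBinomials K τ p).Finite := by
  have hfin : {u | Minimal (· ∈ nonstandard τ p) u}.Finite :=
    WellQuasiOrderedLE.finite_of_isAntichain (setOfPred_minimal_antichain _)
  choose nf hnf hP using exists_notMem_nonstandard (τ := τ) (p := p)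
  refine (hfin.image fun u => (monomial u 1 - monomial (nf u) 1 : MvPolynomial ι K)).subset ?_
  rintro _ ⟨u, v, hu, hv, h, rfl⟩
  exact ⟨u, hu, by rw [eq_of_notMem_nonstandard hv (hnf u) (h.trans (hP u).symm)]⟩

theorem isReducedGroebnerBasis_reducedBinomials [Finite ι] :
    IsReducedGroebnerBasis τ (expKer K p) (reducedBinomials K τ p) where
  finite := finite_reducedBinomials
  subset := by
    rintro _ ⟨u, v, hu, hv, h, rfl⟩
    exact monomial_sub_monomial_mem_expKer.2 h.symm
  monic := by
    rintro _ ⟨u, v, hu, hv, h, rfl⟩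
    exact monic_monomial_sub_monomial (lt_of_notMem_nonstandard hu.1 hv h)
  span_leadingTerm := by
    rw [leadingTerm_image_reducedBinomials, initialIdeal_expKer_eq_span_minimal]
  minimal := by
    classical
    rintro _ ⟨u, v, hu, hv, h, rfl⟩ hmem
    rw [leadingTerm_monomial_sub_monomial (lt_of_notMem_nonstandard hu.1 hv h)] at hmem
    have hsub : τ.leadingTerm '' (reducedBinomials K τ p \ {monomial u 1 - monomial v 1}) ⊆
        (fun a => monomial a (1 : K)) '' {a | Minimal (· ∈ nonstandard τ p) a ∧ a ≠ u} := by
      rintro _ ⟨_, ⟨⟨a, b, ha, hb, hab, rfl⟩, hne⟩, rfl⟩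
      refine ⟨a, ⟨ha, ?_⟩,
        (leadingTerm_monomial_sub_monomial (lt_of_notMem_nonstandard ha.1 hb hab)).symm⟩
      rintro rfl
      exact hne (by rw [eq_of_notMem_nonstandard hb hv (hab.trans h.symm)]; rfl)
    have := Ideal.span_mono hsub hmem
    simp only [mem_ideal_span_monomial_image, support_monomial, one_ne_zero,
      if_false, Finset.mem_singleton, forall_eq] at this
    obtain ⟨a, ⟨ha, hne⟩, hle⟩ := this
    exact hne (le_antisymm hle (hu.2 ha.1 hle))
  trailing := by
    classical
    rintro _ ⟨u, v, hu, hv, h, rfl⟩ a ha hne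
    have hlt := lt_of_notMem_nonstandard hu.1 hv h
    rw [degree_monomial_sub_monomial hlt] at hne
    rw [monomial_mem_initialIdeal]
    rw [mem_support_iff, coeff_sub, coeff_monomial, coeff_monomial, if_neg hne.symm] at ha
    have : v = a := by
      by_contra hva
      simp [hva] at ha
    exact this ▸ hv

theorem IsReducedGroebnerBasis.leadingTerm_eq {H : Set (MvPolynomial ι K)}
    {I : Ideal (MvPolynomial ι K)} (hH : IsReducedGroebnerBasis τ I H) {g : MvPolynomial ι K}
    (hg : g ∈ H) : τ.leadingTerm g = monomial (τ.degree g) 1 := by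
  rw [MonomialOrder.leadingTerm, (hH.monic g hg).leadingCoeff_eq_one]

theorem IsReducedGroebnerBasis.image_degree {H : Set (MvPolynomial ι K)}
    (hH : IsReducedGroebnerBasis τ (expKer K p) H) :
    τ.degree '' H = {u | Minimal (· ∈ nonstandard τ p) u} := by
  classical
  have himg : ∀ S ⊆ H, τ.leadingTerm '' S = (fun a => monomial a (1 : K)) '' (τ.degree '' S) := by
    intro S hS
    rw [Set.image_image]
    exact Set.image_congr fun g hg => hH.leadingTerm_eq (hS hg)
  have hmem : ∀ S ⊆ H, ∀ a : ι →₀ ℕ, monomial a (1 : K) ∈ Ideal.span (τ.leadingTerm '' S) ↔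
      ∃ g ∈ S, τ.degree g ≤ a := by
    intro S hS a
    rw [himg S hS, mem_ideal_span_monomial_image]
    simp
  have hN : ∀ a, a ∈ nonstandard τ p ↔ ∃ g ∈ H, τ.degree g ≤ a := fun a => by
    rw [← hmem H subset_rfl, hH.span_leadingTerm, monomial_mem_initialIdeal]
  ext u
  constructor
  · rintro ⟨g, hg, rfl⟩
    refine ⟨(hN _).2 ⟨g, hg, le_rfl⟩, fun a ha hle => ?_⟩
    obtain ⟨g', hg', hle'⟩ := (hN a).1 ha
    by_cases h : g' = g
    · exact h ▸ hle'
    · refine absurd ?_ (hH.minimal g hg)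
      rw [hH.leadingTerm_eq hg, hmem _ Set.sdiff_subset]
      exact ⟨g', ⟨hg', h⟩, hle'.trans hle⟩
  · intro hu
    obtain ⟨g, hg, hle⟩ := (hN u).1 hu.1
    exact ⟨g, hg, le_antisymm hle (hu.2 ((hN _).2 ⟨g, hg, le_rfl⟩) hle)⟩

/-- Elements of the two bases with the same leading exponent differ only in trailing terms. If the
difference were nonzero, its leading exponent would be a trailing one and yet lie in the initial
ideal. -/
theorem IsReducedGroebnerBasis.subset_of_isReducedGroebnerBasis {H H' : Set (MvPolynomial ι K)}
    (hH : IsReducedGroebnerBasis τ (expKer K p) H)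
    (hH' : IsReducedGroebnerBasis τ (expKer K p) H') : H ⊆ H' := by
  intro g hg
  have : τ.degree g ∈ τ.degree '' H' := by
    rw [hH'.image_degree, ← hH.image_degree]
    exact ⟨g, hg, rfl⟩
  obtain ⟨g', hg', hd⟩ := this
  suffices g - g' = 0 by rwa [sub_eq_zero.1 this]
  by_contra h0
  have hN := degree_mem_nonstandard (τ := τ) (Ideal.sub_mem _ (hH.subset hg) (hH'.subset hg')) h0
  have hsup := τ.degree_mem_support h0
  rw [← monomial_mem_initialIdeal (K := K)] at hN
  have hne : τ.degree (g - g') ≠ τ.degree g := by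
    intro h
    rw [mem_support_iff, h, coeff_sub, (hH.monic g hg).coeff_degree, ← hd,
      (hH'.monic g' hg').coeff_degree, sub_self] at hsup
    exact hsup rfl
  classical
  rcases Finset.mem_union.1 (support_sub _ _ _ hsup) with h | h
  · exact hH.trailing g hg _ h hne hN
  · exact hH'.trailing g' hg' _ h (hd ▸ hne) hN

instance isPrime_expKer : (expKer K p).IsPrime :=
  RingHom.ker_isPrime _

/-- The ideal is prime, so one factor lies in it. Its leading exponent is nonstandard and at most u,
hence equals u, and the other factor is constant. -/
theorem irreducible_of_mem_reducedBinomials {b : MvPolynomial ι K}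
    (hb : b ∈ reducedBinomials K τ p) : Irreducible b := by
  obtain ⟨u, v, hu, hv, h, rfl⟩ := hb
  have hlt := lt_of_notMem_nonstandard hu.1 hv h
  have hmem : (monomial u 1 - monomial v 1 : MvPolynomial ι K) ∈ expKer K p :=
    monomial_sub_monomial_mem_expKer.2 h.symm
  have hne : (monomial u 1 - monomial v 1 : MvPolynomial ι K) ≠ 0 :=
    (monic_monomial_sub_monomial hlt).ne_zero
  have key : ∀ f g : MvPolynomial ι K, (monomial u 1 - monomial v 1 : MvPolynomial ι K) = f * g →
      f ∈ expKer K p → IsUnit g := by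
    intro f g hfg hf
    have hf0 : f ≠ 0 := fun h0 => hne (by rw [hfg, h0, zero_mul])
    have hg0 : g ≠ 0 := fun h0 => hne (by rw [hfg, h0, mul_zero])
    have hd := τ.degree_mul hf0 hg0
    rw [← hfg, degree_monomial_sub_monomial hlt] at hd
    have hle : u ≤ τ.degree f :=
      hu.2 (degree_mem_nonstandard hf hf0) (hd ▸ le_self_add)
    have h0 : τ.degree g = 0 := by
      have : τ.degree f + τ.degree g ≤ τ.degree f := hd ▸ hle
      simpa using this
    rw [τ.eq_C_of_degree_eq_zero h0]
    exact (IsUnit.mk0 _ (τ.leadingCoeff_ne_zero_iff.2 hg0)).map C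
  refine ⟨fun hunit => Ideal.IsPrime.ne_top inferInstance (Ideal.eq_top_of_isUnit_mem _ hmem hunit),
    fun f g hfg => ?_⟩
  rcases Ideal.IsPrime.mem_or_mem (I := expKer K p) inferInstance (hfg ▸ hmem) with hf | hg
  · exact Or.inr (key f g hfg hf)
  · exact Or.inl (key g f (hfg.trans (mul_comm _ _)) hg)

/-- A minimal nonstandard exponent and the smallest exponent in its fiber have no proper
subexponents with the same image. -/
theorem primitive_of_minimal {u v u' v' : ι →₀ ℕ} (hp : ∀ i, p i ≠ 0)
    (hu : Minimal (· ∈ nonstandard τ p) u)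
    (hv : v ∉ nonstandard τ p)
    (h : Finsupp.linearCombination ℕ p v = Finsupp.linearCombination ℕ p u)
    (hu' : u' ≤ u) (hv' : v' ≤ v)
    (h' : Finsupp.linearCombination ℕ p v' = Finsupp.linearCombination ℕ p u') :
    (u' = 0 ∧ v' = 0) ∨ (u' = u ∧ v' = v) := by
  have hP0 : ∀ a : ι →₀ ℕ, Finsupp.linearCombination ℕ p a = 0 → a = 0 := by
    intro a ha
    rw [Finsupp.linearCombination_apply, Finsupp.sum, Finset.sum_eq_zero_iff] at ha
    ext i
    by_contra hi
    have := ha i (Finsupp.mem_support_iff.2 hi)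
    rcases smul_eq_zero.1 this with h1 | h1
    · exact hi h1
    · exact hp i h1
  -- If v' is smaller, u' is nonstandard and equals u. If they are equal, cancelling them leaves a
  -- nonstandard exponent below u, so nothing was cancelled. If u' is smaller, v' and hence v would
  -- be nonstandard.
  rcases lt_trichotomy (τ.toSyn v') (τ.toSyn u') with hlt | heq | hlt
  · obtain rfl : u' = u := le_antisymm hu' (hu.2 ⟨v', hlt, h'⟩ hu')
    refine Or.inr ⟨rfl, ?_⟩
    obtain ⟨c, rfl⟩ := exists_add_of_le hv'
    rw [map_add, ← h', add_eq_left] at h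
    rw [hP0 c h, add_zero]
  · obtain rfl := τ.toSyn.injective heq
    left
    suffices v' = 0 from ⟨this, this⟩
    obtain ⟨a, rfl⟩ := exists_add_of_le hu'
    obtain ⟨b, rfl⟩ := exists_add_of_le hv'
    have hlt := lt_of_notMem_nonstandard hu.1 hv h
    rw [map_add, map_add, add_lt_add_iff_left] at hlt
    rw [map_add, map_add, add_right_inj] at h
    have := hu.2 ⟨b, hlt, h⟩ le_add_self
    simpa using this
  · exact absurd (isUpperSet_nonstandard hv' ⟨u', hlt, h'.symm⟩) hv

end Toric

end GapFree

namespace GapFree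

/-! ### Repeated vertices of extremal walks. -/

section Walk

variable {V : Type*}

/-- The signed vertex `(-1)^k w_k` of a walk `w`. -/
noncomputable def signedVertex (w : ℕ → V) (k : ℕ) : V →₀ ℤ := Finsupp.single (w k) ((-1) ^ k)

/-- The vertex degrees of the edges `{w_k, w_{k+1}}`, `k ∈ T`, where edges at odd positions count
negatively. -/
noncomputable def excess (w : ℕ → V) (T : Finset ℕ) : V →₀ ℤ :=
  ∑ k ∈ T, (signedVertex w k - signedVertex w (k + 1))

variable {w : ℕ → V}

theorem signedVertex_of_even {k : ℕ} (h : k % 2 = 0) :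
    signedVertex w k = Finsupp.single (w k) 1 := by
  rw [signedVertex, (Nat.even_iff.2 h).neg_one_pow]

theorem signedVertex_of_odd {k : ℕ} (h : k % 2 = 1) :
    signedVertex w k = -Finsupp.single (w k) 1 := by
  rw [signedVertex, (Nat.odd_iff.2 h).neg_one_pow, Finsupp.single_neg]

theorem signedVertex_zero : signedVertex w 0 = Finsupp.single (w 0) 1 :=
  signedVertex_of_even rfl

theorem signedVertex_eq_neg {s t : ℕ} (h : (s + t) % 2 = 1) (hw : w s = w t) :
    signedVertex w t = -signedVertex w s := by
  rcases Nat.mod_two_eq_zero_or_one s with hs | hs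
  · rw [signedVertex_of_even hs, signedVertex_of_odd (by omega), hw]
  · rw [signedVertex_of_odd hs, signedVertex_of_even (by omega), hw, neg_neg]

theorem signedVertex_eq {s t : ℕ} (h : (s + t) % 2 = 0) (hw : w s = w t) :
    signedVertex w t = signedVertex w s := by
  rcases Nat.mod_two_eq_zero_or_one s with hs | hs
  · rw [signedVertex_of_even hs, signedVertex_of_even (by omega), hw]
  · rw [signedVertex_of_odd hs, signedVertex_of_odd (by omega), hw]

/-- The sum telescopes, so the balance of a union of intervals depends only on their end points. -/
theorem excess_Ico {a b : ℕ} (h : a ≤ b) :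
    excess w (Finset.Ico a b) = signedVertex w a - signedVertex w b := by
  rw [excess, ← neg_inj, ← Finset.sum_neg_distrib]
  simp only [neg_sub]
  exact Finset.sum_Ico_sub _ h

theorem excess_union {S T : Finset ℕ} (h : Disjoint S T) :
    excess w (S ∪ T) = excess w S + excess w T :=
  Finset.sum_union h

theorem excess_two {a b c d : ℕ} (hab : a ≤ b) (hbc : b ≤ c) (hcd : c ≤ d) :
    excess w (Finset.Ico a b ∪ Finset.Ico c d) =
      (signedVertex w a - signedVertex w b) + (signedVertex w c - signedVertex w d) := by
  rw [excess_union, excess_Ico hab, excess_Ico hcd]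
  rw [Finset.disjoint_left]
  simp only [Finset.mem_Ico]
  omega

theorem excess_four {a₁ b₁ a₂ b₂ a₃ b₃ a₄ b₄ : ℕ} (h₁ : a₁ ≤ b₁) (h₁' : b₁ ≤ a₂) (h₂ : a₂ ≤ b₂)
    (h₂' : b₂ ≤ a₃) (h₃ : a₃ ≤ b₃) (h₃' : b₃ ≤ a₄) (h₄ : a₄ ≤ b₄) :
    excess w ((Finset.Ico a₁ b₁ ∪ Finset.Ico a₂ b₂) ∪ (Finset.Ico a₃ b₃ ∪ Finset.Ico a₄ b₄)) =
      (signedVertex w a₁ - signedVertex w b₁) + (signedVertex w a₂ - signedVertex w b₂) +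
      ((signedVertex w a₃ - signedVertex w b₃) + (signedVertex w a₄ - signedVertex w b₄)) := by
  rw [excess_union, excess_two h₁ h₁' h₂, excess_two h₃ h₃' h₄]
  rw [Finset.disjoint_left]
  simp only [Finset.mem_union, Finset.mem_Ico]
  omega

variable [LinearOrder V]

/-- A closed walk of even length that has no proper balanced subset of edges, whose first edge has
the smallest larger end, and for which no balanced set of edges that contains the first edge,
completed by an edge of `G` after it, omits an edge at an even position. -/
structure IsExtremalWalk (G : SimpleGraph V) (L : ℕ) (w : ℕ → V) : Prop where
  pos : 0 < L
  even : L % 2 = 0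
  closed : w L = w 0
  adj : ∀ k < L, G.Adj (w k) (w (k + 1))
  max_le : ∀ k < L, max (w 0) (w 1) ≤ max (w k) (w (k + 1))
  primitive : ∀ T ⊆ Finset.range L, excess w T = 0 → T = ∅ ∨ T = Finset.range L
  chord : ∀ T ⊆ Finset.range L, 0 ∈ T → ∀ x y, G.Adj x y →
    (max (w 0) (w 1) < x ∨ max (w 0) (w 1) < y ∨
      ∃ k < L, k % 2 = 1 ∧ x = w k ∧ y = w (k + 1)) →
    excess w T = Finsupp.single x 1 + Finsupp.single y 1 → ∀ k < L, k % 2 = 0 → k ∈ T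

namespace IsExtremalWalk

variable {G : SimpleGraph V} {L : ℕ}

theorem signedVertex_last (hw : IsExtremalWalk G L w) :
    signedVertex w L = Finsupp.single (w 0) 1 := by
  rw [signedVertex_of_even hw.even, hw.closed]

/-- The set T is a union of four intervals, the first of which starts at 0; four suffice for all the
chords below, and superfluous ones are taken empty. The position k is an even one outside T. -/
theorem chord_false (hw : IsExtremalWalk G L w) {b₁ a₂ b₂ a₃ b₃ a₄ b₄ : ℕ} {x y : V} (h₁ : 1 ≤ b₁)
    (h₁' : b₁ ≤ a₂) (h₂ : a₂ ≤ b₂) (h₂' : b₂ ≤ a₃) (h₃ : a₃ ≤ b₃) (h₃' : b₃ ≤ a₄) (h₄ : a₄ ≤ b₄)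
    (hL : b₄ ≤ L) (hadj : G.Adj x y)
    (hlow : max (w 0) (w 1) < x ∨ max (w 0) (w 1) < y ∨
      ∃ k < L, k % 2 = 1 ∧ x = w k ∧ y = w (k + 1))
    (hx : (signedVertex w 0 - signedVertex w b₁) + (signedVertex w a₂ - signedVertex w b₂) +
      ((signedVertex w a₃ - signedVertex w b₃) + (signedVertex w a₄ - signedVertex w b₄)) =
      Finsupp.single x 1 + Finsupp.single y 1)
    (hk : ∃ k < L, k % 2 = 0 ∧ b₁ ≤ k ∧ (k < a₂ ∨ b₂ ≤ k) ∧ (k < a₃ ∨ b₃ ≤ k) ∧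
      (k < a₄ ∨ b₄ ≤ k)) : False := by
  obtain ⟨k, hkL, hk2, hk⟩ := hk
  rw [← excess_four (Nat.zero_le _) h₁' h₂ h₂' h₃ h₃' h₄] at hx
  have := hw.chord _ (fun i hi => ?_) ?_ x y hadj hlow hx k hkL hk2
  · simp only [Finset.mem_union, Finset.mem_Ico] at this
    omega
  · simp only [Finset.mem_union, Finset.mem_Ico] at hi
    rw [Finset.mem_range]
    omega
  · simp only [Finset.mem_union, Finset.mem_Ico]
    omega

/-- Otherwise the segment would be balanced, and it is proper because it misses position 0.
Positions run from 1 to L here and below, since 0 and L are the same visit. -/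
theorem parity (hw : IsExtremalWalk G L w) {s t : ℕ} (hs : 1 ≤ s) (hst : s < t) (ht : t ≤ L)
    (h : w s = w t) : (s + t) % 2 = 1 := by
  by_contra hp
  have hx : excess w (Finset.Ico s t) = 0 := by
    rw [excess_Ico hst.le, signedVertex_eq (by omega) h, sub_self]
  have hsub : Finset.Ico s t ⊆ Finset.range L := fun i hi => by
    simp only [Finset.mem_Ico] at hi
    rw [Finset.mem_range]
    omega
  rcases hw.primitive _ hsub hx with h' | h'
  · have : s ∈ Finset.Ico s t := by simp [hst]
    simp [h'] at this
  · have : 0 ∈ Finset.Ico s t := h' ▸ Finset.mem_range.2 hw.pos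
    simp at this
    omega

theorem no_three (hw : IsExtremalWalk G L w) {i j k : ℕ} (hi : 1 ≤ i) (hij : i < j) (hjk : j < k)
    (hk : k ≤ L) (h : w i = w j) (h' : w j = w k) : False := by
  have := hw.parity hi hij (by omega) h
  have := hw.parity (by omega) hjk hk h'
  have := hw.parity hi (by omega) hk (h.trans h')
  omega

/-- Repeated vertices carry opposite signs, so the two intervals from s₁ to s₂ and from t₁ to t₂
balance each other. -/
theorem no_cross (hw : IsExtremalWalk G L w) {s₁ s₂ t₁ t₂ : ℕ} (h₁ : 1 ≤ s₁) (h₁₂ : s₁ < s₂)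
    (h₂ : s₂ < t₁) (h₂' : t₁ < t₂) (ht : t₂ ≤ L) (h : w s₁ = w t₁) (h' : w s₂ = w t₂) : False := by
  have hx : excess w (Finset.Ico s₁ s₂ ∪ Finset.Ico t₁ t₂) = 0 := by
    rw [excess_two h₁₂.le h₂.le h₂'.le,
      signedVertex_eq_neg (hw.parity h₁ (by omega) (by omega) h) h,
      signedVertex_eq_neg (hw.parity (by omega) (by omega) ht h') h']
    abel
  have hsub : Finset.Ico s₁ s₂ ∪ Finset.Ico t₁ t₂ ⊆ Finset.range L := fun i hi => by
    simp only [Finset.mem_union, Finset.mem_Ico] at hi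
    rw [Finset.mem_range]
    omega
  rcases hw.primitive _ hsub hx with h' | h'
  · have : s₁ ∈ Finset.Ico s₁ s₂ ∪ Finset.Ico t₁ t₂ := by simp [h₁₂]
    simp [h'] at this
  · have : 0 ∈ Finset.Ico s₁ s₂ ∪ Finset.Ico t₁ t₂ := h' ▸ Finset.mem_range.2 hw.pos
    simp at this
    omega

/-- A vertex that occurs before a closed segment does not occur in it. -/
theorem ne_of_lt_segment (hw : IsExtremalWalk G L w) {i s t k : ℕ} (hi : 1 ≤ i) (his : i < s)
    (hsk : s ≤ k) (hkt : k ≤ t) (hst : s < t) (ht : t ≤ L) (h : w s = w t) : w i ≠ w k := by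
  intro hik
  rcases hsk.eq_or_lt with rfl | hsk
  · exact hw.no_three hi his hst ht hik h
  rcases hkt.eq_or_lt with rfl | hkt
  · exact hw.no_three hi his hst ht (hik.trans h.symm) h
  · exact hw.no_cross hi his hsk hkt ht hik h

/-- A vertex that occurs after a closed segment does not occur in it. -/
theorem ne_of_segment_lt (hw : IsExtremalWalk G L w) {i s t k : ℕ} (hs : 1 ≤ s)
    (hsk : s ≤ k) (hkt : k ≤ t) (hst : s < t) (hti : t < i) (hi : i ≤ L) (h : w s = w t) :
    w k ≠ w i := by
  intro hik
  rcases hsk.eq_or_lt with rfl | hsk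
  · exact hw.no_three hs hst hti hi h (h.symm.trans hik)
  rcases hkt.eq_or_lt with rfl | hkt
  · exact hw.no_three hs hst hti hi h hik
  · exact hw.no_cross hs hsk hkt hti hi h hik

/-- An odd closed segment contains an edge both of whose ends are at least the larger end of the
first edge. -/
theorem exists_high_edge (hw : IsExtremalWalk G L w) {s t : ℕ} (hs : 1 ≤ s) (hst : s < t)
    (ht : t ≤ L) (h : w s = w t) :
    ∃ k, s ≤ k ∧ k < t ∧ max (w 0) (w 1) ≤ w k ∧ max (w 0) (w 1) ≤ w (k + 1) := by
  by_contra! hcon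
  have hp := hw.parity hs hst ht h
  -- Every edge has an end that is at least the bound. If none has two, high and low vertices
  -- alternate, which is impossible around an odd segment.
  have key : ∀ n, s + n ≤ t → (max (w 0) (w 1) ≤ w (s + n) ↔
      (n % 2 = 0 ↔ max (w 0) (w 1) ≤ w s)) := by
    intro n
    induction n with
    | zero => simp
    | succ n ih =>
      intro hn
      have ih := ih (by omega)
      have h1 := hw.max_le (s + n) (by omega)
      have h2 := hcon (s + n) (by omega) (by omega)
      rw [le_max_iff] at h1
      rw [← not_le] at h2
      rw [show s + (n + 1) = s + n + 1 by omega]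
      rcases Nat.mod_two_eq_zero_or_one n with h0 | h0 <;>
      · have h3 : (n + 1) % 2 = 1 - n % 2 := by omega
        rw [h3, h0]
        rw [h0] at ih
        simp only [tsub_zero, tsub_self, one_ne_zero, false_iff, true_iff] at ih ⊢
        tauto
  have := key (t - s) (by omega)
  rw [show s + (t - s) = t by omega, show (t - s) % 2 = 1 by omega, h] at this
  simp only [one_ne_zero, false_iff] at this
  tauto

theorem exists_higher_edge (hw : IsExtremalWalk G L w) {s t : ℕ} (hs : 1 ≤ s) (hst : s < t)
    (ht : t ≤ L) (h : w s = w t) (hne : ∀ k, s ≤ k → k ≤ t → w k ≠ max (w 0) (w 1)) :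
    ∃ k, s ≤ k ∧ k < t ∧ max (w 0) (w 1) < w k ∧ max (w 0) (w 1) < w (k + 1) := by
  obtain ⟨k, h1, h2, h3, h4⟩ := hw.exists_high_edge hs hst ht h
  exact ⟨k, h1, h2, lt_of_le_of_ne h3 (hne k h1 h2.le).symm,
    lt_of_le_of_ne h4 (hne (k + 1) (by omega) (by omega)).symm⟩

/-- In a gap-free graph, edges without common vertices are linked. -/
theorem exists_link (hw : IsExtremalWalk G L w) (hG : IsGapFree G) {i j : ℕ} (hi : i < L)
    (hj : j < L) (hne : ∀ r r', i ≤ r → r ≤ i + 1 → j ≤ r' → r' ≤ j + 1 → w r ≠ w r') :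
    ∃ r r', i ≤ r ∧ r ≤ i + 1 ∧ j ≤ r' ∧ r' ≤ j + 1 ∧ G.Adj (w r) (w r') := by
  rcases hG _ _ _ _ (hw.adj i hi) (hw.adj j hj)
    (hne _ _ (by omega) (by omega) (by omega) (by omega))
    (hne _ _ (by omega) (by omega) (by omega) (by omega))
    (hne _ _ (by omega) (by omega) (by omega) (by omega))
    (hne _ _ (by omega) (by omega) (by omega) (by omega)) with h | h | h | h
  · exact ⟨_, _, by omega, by omega, by omega, by omega, h⟩
  · exact ⟨_, _, by omega, by omega, by omega, by omega, h⟩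
  · exact ⟨_, _, by omega, by omega, by omega, by omega, h⟩
  · exact ⟨_, _, by omega, by omega, by omega, by omega, h⟩

/-- The signs at s₁ and t₁ cancel, so w r can be reached from the start either directly or by
jumping from s₁ to r and going on to t₁. The parity of r decides which way gives it a positive sign.
The same choice at r', on the way to L, leaves exactly w r + w r'. -/
theorem no_chord_between_segments (hw : IsExtremalWalk G L w) {s₁ t₁ s₂ t₂ r r' : ℕ} (h₁ : 1 ≤ s₁)
    (h₁' : s₁ < t₁) (h₁₂ : t₁ < s₂) (h₂ : s₂ < t₂) (h₂' : t₂ ≤ L) (h : w s₁ = w t₁)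
    (h' : w s₂ = w t₂) (hr₁ : s₁ ≤ r) (hr₂ : r ≤ t₁) (hr₁' : s₂ ≤ r') (hr₂' : r' ≤ t₂)
    (hr : s₁ < r ∧ r < t₁ ∨ s₂ < r' ∧ r' < t₂)
    (hlow : max (w 0) (w 1) < w r ∨ max (w 0) (w 1) < w r') : ¬ G.Adj (w r) (w r') := by
  intro hadj
  have hp := hw.parity h₁ h₁' (by omega) h
  have hp' := hw.parity (by omega) h₂ h₂' h'
  have hs := signedVertex_eq_neg hp h
  have hs' := signedVertex_eq_neg hp' h'
  have hlow' : max (w 0) (w 1) < w r ∨ max (w 0) (w 1) < w r' ∨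
      ∃ k < L, k % 2 = 1 ∧ w r = w k ∧ w r' = w (k + 1) := by tauto
  have hLL := hw.even
  -- An omitted even position, for all four parity cases at once. That the chord ends inside a
  -- segment matters only if t₁ is odd and s₂ = t₁ + 1.
  have hk : ∃ k < L, k % 2 = 0 ∧ s₁ ≤ k ∧ k < t₂ ∧
      (k < s₁ ∨ (if r % 2 = 1 then r else t₁) ≤ k ∨
        (k < r ∧ r % 2 = 0)) ∧
      (s₂ ≤ k ∨ t₁ ≤ k ∨ (if r % 2 = 1 then r ≤ k else k < r)) ∧
      (k < s₂ ∨ (if r' % 2 = 0 then k < r' else r' ≤ k)) := by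
    by_cases ht : t₁ % 2 = 0
    · refine ⟨t₁, ?_⟩
      split_ifs <;> omega
    by_cases h2 : s₂ = t₁ + 1
    · rcases hr with hr | hr
      · by_cases hro : r % 2 = 1
        · refine ⟨r + 1, ?_⟩
          simp only [hro, if_true]
          split_ifs <;> omega
        · refine ⟨s₁, ?_⟩
          simp only [hro, if_false]
          split_ifs <;> omega
      · by_cases hro : r' % 2 = 0
        · refine ⟨s₂, ?_⟩
          split_ifs <;> omega
        · refine ⟨r' + 1, ?_⟩
          split_ifs <;> omega
    · refine ⟨t₁ + 1, ?_⟩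
      split_ifs <;> omega
  have hwL := hw.signedVertex_last
  obtain ⟨k, hk⟩ := hk
  rcases Nat.mod_two_eq_zero_or_one r with hr0 | hr0 <;>
  rcases Nat.mod_two_eq_zero_or_one r' with hr0' | hr0'
  · refine hw.chord_false (b₁ := s₁) (a₂ := r) (b₂ := t₁) (a₃ := r') (b₃ := t₂) (a₄ := t₂)
      (b₄ := L) h₁ ?_ ?_ ?_ ?_ le_rfl ?_ le_rfl hadj hlow' ?_ ⟨k, ?_⟩ <;> try omega
    · rw [hs, hwL, signedVertex_zero, signedVertex_of_even hr0, signedVertex_of_even hr0']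
      abel
    · simp [hr0, hr0'] at hk
      omega
  · refine hw.chord_false (b₁ := s₁) (a₂ := r) (b₂ := t₁) (a₃ := s₂) (b₃ := r') (a₄ := t₂)
      (b₄ := L) h₁ ?_ ?_ ?_ ?_ hr₂' ?_ le_rfl hadj hlow' ?_ ⟨k, ?_⟩ <;> try omega
    · rw [hs, hs', hwL, signedVertex_zero, signedVertex_of_even hr0, signedVertex_of_odd hr0']
      abel
    · simp [hr0, hr0'] at hk
      omega
  · refine hw.chord_false (b₁ := s₁) (a₂ := s₁) (b₂ := r) (a₃ := r') (b₃ := t₂) (a₄ := t₂)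
      (b₄ := L) h₁ ?_ ?_ ?_ ?_ le_rfl ?_ le_rfl hadj hlow' ?_ ⟨k, ?_⟩ <;> try omega
    · rw [hwL, signedVertex_zero, signedVertex_of_odd hr0, signedVertex_of_even hr0']
      abel
    · simp [hr0, hr0'] at hk
      omega
  · refine hw.chord_false (b₁ := s₁) (a₂ := s₁) (b₂ := r) (a₃ := s₂) (b₃ := r') (a₄ := t₂)
      (b₄ := L) h₁ ?_ ?_ ?_ ?_ hr₂' ?_ le_rfl hadj hlow' ?_ ⟨k, ?_⟩ <;> try omega
    · rw [hs', hwL, signedVertex_zero, signedVertex_of_odd hr0, signedVertex_of_odd hr0']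
      abel
    · simp [hr0, hr0'] at hk
      omega

theorem segment_length (hw : IsExtremalWalk G L w) {s t : ℕ} (hs : 1 ≤ s) (hst : s < t)
    (ht : t ≤ L) (h : w s = w t) : s + 2 < t := by
  have hp := hw.parity hs hst ht h
  have : t ≠ s + 1 := by
    rintro rfl
    exact (hw.adj s (by omega)).ne h
  omega

/-- One of the segments avoids the larger end of the first edge, so it contains an edge with both
ends strictly above it. Gap-freeness links that edge to the other segment. -/
theorem no_disjoint_segments (hw : IsExtremalWalk G L w) (hG : IsGapFree G) {s₁ t₁ s₂ t₂ : ℕ}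
    (h₁ : 1 ≤ s₁) (h₁' : s₁ < t₁) (h₁₂ : t₁ < s₂) (h₂ : s₂ < t₂) (h₂' : t₂ ≤ L) (h : w s₁ = w t₁)
    (h' : w s₂ = w t₂) : False := by
  have hl := hw.segment_length h₁ h₁' (by omega) h
  have hl' := hw.segment_length (by omega) h₂ h₂' h'
  have hdisj : ∀ r r', s₁ ≤ r → r ≤ t₁ → s₂ ≤ r' → r' ≤ t₂ → w r ≠ w r' :=
    fun r r' hr₁ hr₂ hr₁' hr₂' =>
      hw.ne_of_lt_segment (by omega) (by omega) hr₁' hr₂' h₂ h₂' h'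
  rcases max_choice (w 0) (w 1) with hβ | hβ
  · obtain ⟨k, hk₁, hk₂, hk₃, hk₄⟩ := hw.exists_higher_edge h₁ h₁' (by omega) h (fun k hk hk' => by
      rw [hβ, ← hw.closed]
      exact hw.ne_of_segment_lt h₁ hk hk' h₁' (by omega) le_rfl h)
    -- The edge at s₂ + 1 has both ends strictly inside its segment, because s₂ + 2 < t₂.
    obtain ⟨r, r', hr₁, hr₂, hr₁', hr₂', hadj⟩ := hw.exists_link hG (i := k) (j := s₂ + 1)
      (by omega) (by omega) (fun r r' _ _ _ _ => hdisj r r' (by omega) (by omega) (by omega)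
        (by omega))
    refine hw.no_chord_between_segments h₁ h₁' h₁₂ h₂ h₂' h h' (by omega) (by omega) (by omega)
      (by omega) (Or.inr (by omega)) (Or.inl ?_) hadj
    obtain rfl | rfl : r = k ∨ r = k + 1 := by omega
    · exact hk₃
    · exact hk₄
  · obtain ⟨k, hk₁, hk₂, hk₃, hk₄⟩ := hw.exists_higher_edge (by omega) h₂ h₂' h'
      (fun k hk hk' => by
        rw [hβ]
        exact (hw.ne_of_lt_segment le_rfl (by omega) hk hk' h₂ h₂' h').symm)
    obtain ⟨r, r', hr₁, hr₂, hr₁', hr₂', hadj⟩ := hw.exists_link hG (i := s₁ + 1) (j := k)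
      (by omega) (by omega) (fun r r' _ _ _ _ => hdisj r r' (by omega) (by omega) (by omega)
        (by omega))
    refine hw.no_chord_between_segments h₁ h₁' h₁₂ h₂ h₂' h h' (by omega) (by omega) (by omega)
      (by omega) (Or.inl (by omega)) (Or.inr ?_) hadj
    obtain rfl | rfl : r' = k ∨ r' = k + 1 := by omega
    · exact hk₃
    · exact hk₄

/-- The segment avoids both ends of the first edge, so gap-freeness links the first edge to a high
edge of the segment. Each end of the link and each parity gives a chord; the stated positions are
those in which it may skip no even position. -/
theorem segment_ends (hw : IsExtremalWalk G L w) (hG : IsGapFree G) {s t : ℕ} (hs : 1 < s)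
    (hst : s < t) (ht : t < L) (h : w s = w t) :
    s = 2 ∧ t % 2 = 1 ∨ t + 1 = L ∧ s % 2 = 0 := by
  by_contra hcon
  have hLL := hw.even
  have hp := hw.parity hs.le hst ht.le h
  have hl := hw.segment_length hs.le hst ht.le h
  have hs' := signedVertex_eq_neg hp h
  have hwL := hw.signedVertex_last
  have ne0 : ∀ k, s ≤ k → k ≤ t → w 0 ≠ w k := fun k hk hk' => by
    rw [← hw.closed]
    exact (hw.ne_of_segment_lt hs.le hk hk' hst ht le_rfl h).symm
  have ne1 : ∀ k, s ≤ k → k ≤ t → w 1 ≠ w k := fun k hk hk' =>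
    hw.ne_of_lt_segment le_rfl hs hk hk' hst ht.le h
  obtain ⟨j, hj₁, hj₂, hj₃, hj₄⟩ := hw.exists_higher_edge hs.le hst ht.le h (fun k hk hk' => by
    rcases max_choice (w 0) (w 1) with hβ | hβ <;> rw [hβ]
    · exact (ne0 k hk hk').symm
    · exact (ne1 k hk hk').symm)
  obtain ⟨i, r, -, hi, hr₁, hr₂, hadj⟩ := hw.exists_link hG (i := 0) (j := j) hw.pos (by omega)
    (fun i r _ hi _ _ => by
      obtain rfl | rfl : i = 0 ∨ i = 1 := by omega
      · exact ne0 r (by omega) (by omega)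
      · exact ne1 r (by omega) (by omega))
  have hlow : max (w 0) (w 1) < w i ∨ max (w 0) (w 1) < w r ∨
      ∃ k < L, k % 2 = 1 ∧ w i = w k ∧ w r = w (k + 1) := by
    right; left
    obtain rfl | rfl : r = j ∨ r = j + 1 := by omega
    · exact hj₃
    · exact hj₄
  obtain rfl | rfl : i = 0 ∨ i = 1 := by omega
  all_goals rcases Nat.mod_two_eq_zero_or_one r with hr0 | hr0
  · refine hw.chord_false (b₁ := s) (a₂ := r) (b₂ := t) (a₃ := t) (b₃ := t) (a₄ := t)
      (b₄ := t) hs.le ?_ ?_ le_rfl le_rfl le_rfl le_rfl ht.le hadj hlow ?_ ?_ <;> try omega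
    · rw [hs', signedVertex_zero, signedVertex_of_even hr0]
      abel
    · by_cases h0 : s % 2 = 0
      · by_cases hrs : r = s
        · exact ⟨t + 1, by omega⟩
        · exact ⟨s, by omega⟩
      · exact ⟨t, by omega⟩
  · refine hw.chord_false (b₁ := r) (a₂ := r) (b₂ := r) (a₃ := r) (b₃ := r) (a₄ := r)
      (b₄ := r) (by omega) le_rfl le_rfl le_rfl le_rfl le_rfl le_rfl (by omega) hadj hlow ?_ ?_
    · rw [signedVertex_zero, signedVertex_of_odd hr0]
      abel
    · exact ⟨r + 1, by omega⟩
  · refine hw.chord_false (b₁ := 1) (a₂ := r) (b₂ := L) (a₃ := L) (b₃ := L) (a₄ := L)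
      (b₄ := L) le_rfl (by omega) (by omega) le_rfl le_rfl le_rfl le_rfl le_rfl hadj hlow ?_ ?_
    · rw [hwL, signedVertex_zero, signedVertex_of_odd (k := 1) rfl, signedVertex_of_even hr0]
      abel
    · exact ⟨2, by omega⟩
  · refine hw.chord_false (b₁ := 1) (a₂ := s) (b₂ := r) (a₃ := t) (b₃ := L) (a₄ := L)
      (b₄ := L) le_rfl (by omega) (by omega) (by omega) (by omega) le_rfl le_rfl le_rfl hadj hlow
      ?_ ?_
    · rw [hs', hwL, signedVertex_zero, signedVertex_of_odd (k := 1) rfl, signedVertex_of_odd hr0]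
      abel
    · by_cases h2 : s = 2
      · exact ⟨r + 1, by omega⟩
      · exact ⟨2, by omega⟩

/-- The chord is now an odd edge of the walk itself, next to the first edge or last. It replaces the
stretch between the two right or the two left ends, which must then be a single odd edge, equal to
the chord. -/
theorem nested_segments (hw : IsExtremalWalk G L w) (hG : IsGapFree G) {s₁ t₁ s₂ t₂ : ℕ}
    (h₁ : 1 ≤ s₁) (h₁' : s₁ < s₂) (h₁₂ : s₂ < t₂) (h₂ : t₂ < t₁) (h₂' : t₁ ≤ L) (h : w s₁ = w t₁)
    (h' : w s₂ = w t₂) : s₁ = 1 ∧ s₂ = 2 ∧ t₁ = t₂ + 1 ∧ t₁ % 2 = 0 ∨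
      t₁ = L ∧ t₂ + 1 = L ∧ s₂ = s₁ + 1 ∧ s₂ % 2 = 0 := by
  have hLL := hw.even
  have hp := hw.parity h₁ (by omega) (by omega) h
  have hp' := hw.parity (by omega) h₁₂ (by omega) h'
  have hs := signedVertex_eq_neg hp h
  have hs' := signedVertex_eq_neg hp' h'
  have hwL := hw.signedVertex_last
  rcases hw.segment_ends hG (by omega) h₁₂ (by omega) h' with ⟨h2, h3⟩ | ⟨h2, h3⟩
  · left
    obtain rfl : s₁ = 1 := by omega
    subst h2
    refine ⟨rfl, rfl, ?_, by omega⟩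
    by_contra hne
    refine hw.chord_false (b₁ := t₂) (a₂ := t₁) (b₂ := L) (a₃ := L) (b₃ := L) (a₄ := L)
      (b₄ := L) (by omega) (by omega) (by omega) le_rfl le_rfl le_rfl le_rfl le_rfl
      (hw.adj 1 (by omega)) (Or.inr (Or.inr ⟨1, by omega, rfl, rfl, rfl⟩)) ?_ ⟨t₂ + 1, by omega⟩
    rw [hs, hs', hwL, signedVertex_zero, signedVertex_of_odd (k := 1) rfl,
      signedVertex_of_even (k := 2) rfl]
    abel
  · right
    obtain rfl : t₁ = L := by omega
    refine ⟨rfl, h2, ?_, h3⟩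
    by_contra hne
    refine hw.chord_false (b₁ := s₁) (a₂ := s₂) (b₂ := t₁) (a₃ := t₁) (b₃ := t₁) (a₄ := t₁)
      (b₄ := t₁) (by omega) (by omega) (by omega) le_rfl le_rfl le_rfl le_rfl le_rfl
      (hw.adj t₂ (by omega)) (Or.inr (Or.inr ⟨t₂, by omega, by omega, rfl, rfl⟩)) ?_
      ⟨s₁ + 1, by omega⟩
    rw [h2, hwL, signedVertex_zero, signedVertex_of_odd (k := s₁) (by omega),
      signedVertex_of_even h3, h, h', hw.closed]
    abel

/-- A repetition in the same direction contradicts `parity`. In opposite directions it gives nested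
segments, whose double edge sits at odd positions, or disjoint ones if i = 0. -/
theorem even_edge_injective (hw : IsExtremalWalk G L w) (hG : IsGapFree G) {i j : ℕ} (hij : i < j)
    (hj : j < L) (hi2 : i % 2 = 0) (hj2 : j % 2 = 0) :
    s(w i, w (i + 1)) ≠ s(w j, w (j + 1)) := by
  have hLL := hw.even
  intro h
  rcases Sym2.eq_iff.1 h with ⟨h1, h2⟩ | ⟨h1, h2⟩
  · have := hw.parity (by omega) (by omega) (by omega) h2
    omega
  · rcases Nat.eq_zero_or_pos i with rfl | hi
    · rw [← hw.closed] at h1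
      exact hw.no_disjoint_segments hG le_rfl (by omega) (by omega) (by omega) le_rfl h2 h1.symm
    · have := hw.nested_segments hG hi (by omega) (by omega) (by omega) (by omega) h1 h2
      omega

end IsExtremalWalk

end Walk

end GapFree

namespace GapFree

/-! ### Balanced weights on a walk. -/

section Weights

variable {V : Type*} {w : ℕ → V} {L : ℕ} {y : ℕ → ℚ}

/-- The jump of the signed weights `(-1)^k y_k` at the `k`-th vertex of a walk. -/
def jump (y : ℕ → ℚ) (k : ℕ) : ℚ := (-1) ^ k * y k - (-1) ^ (k - 1) * y (k - 1)

theorem jump_eq {k : ℕ} (hk : 1 ≤ k) : jump y k = (-1) ^ k * (y (k - 1) + y k) := by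
  obtain ⟨n, rfl⟩ := Nat.exists_eq_add_of_le' hk
  simp only [jump, Nat.add_sub_cancel]
  ring

theorem sum_jump {a b : ℕ} (hab : a ≤ b) :
    ∑ k ∈ Finset.Ioc a b, jump y k = (-1) ^ b * y b - (-1) ^ a * y a := by
  induction b, hab using Nat.le_induction with
  | base => simp
  | succ b hab ih =>
    rw [← Finset.insert_Ioc_right_eq_Ioc_add_one hab, Finset.sum_insert (by simp), ih]
    simp [jump]

theorem sum_single_vertex (hc : w L = w 0) (hy : y L = y 0)
    (hsum : ∑ k ∈ Finset.range L,
      (Finsupp.single (w k) (y k) + Finsupp.single (w (k + 1)) (y k)) = 0) :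
    ∑ k ∈ Finset.range L, Finsupp.single (w (k + 1)) (y k + y (k + 1)) = 0 := by
  have h := (Finset.sum_range_succ (fun k => Finsupp.single (w k) (y k)) L).symm.trans
    (Finset.sum_range_succ' (fun k => Finsupp.single (w k) (y k)) L)
  rw [hc, hy, add_left_inj] at h
  rw [Finset.sum_add_distrib, h, ← Finset.sum_add_distrib] at hsum
  rw [← hsum]
  exact Finset.sum_congr rfl fun k _ => by rw [← Finsupp.single_add, add_comm (y k)]

theorem jump_eq_zero (hsum : ∑ k ∈ Finset.range L, Finsupp.single (w (k + 1)) (y k + y (k + 1)) = 0)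
    {i : ℕ} (hi : 1 ≤ i) (hiL : i ≤ L) (hne : ∀ j, 1 ≤ j → j ≤ L → w j = w i → j = i) :
    jump y i = 0 := by
  classical
  obtain ⟨n, rfl⟩ := Nat.exists_eq_add_of_le' hi
  have := DFunLike.congr_fun hsum (w (n + 1))
  rw [Finsupp.finsetSum_apply, Finset.sum_eq_single n] at this
  · rw [jump_eq hi]
    simpa using this
  · intro b hb hbn
    rw [Finset.mem_range] at hb
    rw [Finsupp.single_apply, if_neg]
    intro h
    have := hne _ (by omega) (by omega) h
    omega
  · intro h
    rw [Finset.mem_range] at h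
    omega

/-- The two visits contribute opposite sums of adjacent weights, and the opposite parities turn this
into equal jumps. -/
theorem jump_eq_jump
    (hsum : ∑ k ∈ Finset.range L, Finsupp.single (w (k + 1)) (y k + y (k + 1)) = 0)
    {s t : ℕ} (hs : 1 ≤ s) (hst : s < t) (ht : t ≤ L) (hp : (s + t) % 2 = 1) (h : w s = w t)
    (hne : ∀ j, 1 ≤ j → j ≤ L → w j = w s → j = s ∨ j = t) : jump y s = jump y t := by
  classical
  obtain ⟨a, rfl⟩ := Nat.exists_eq_add_of_le' hs
  obtain ⟨b, rfl⟩ := Nat.exists_eq_add_of_le' (show 1 ≤ t by omega)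
  have := DFunLike.congr_fun hsum (w (a + 1))
  rw [Finsupp.finsetSum_apply, Finset.sum_eq_add_of_mem a b (by simp; omega) (by simp; omega)
    (by omega)] at this
  · rw [jump_eq hs, jump_eq (by omega)]
    rw [← h, Finsupp.single_eq_same, Finsupp.single_eq_same, Finsupp.zero_apply] at this
    simp only [Nat.add_sub_cancel]
    have hpow : (-1 : ℚ) ^ (b + 1) = -(-1) ^ (a + 1) := by
      rcases Nat.mod_two_eq_zero_or_one a with h0 | h0
      · rw [(Nat.odd_iff.2 (by omega) : Odd (a + 1)).neg_one_pow,
          (Nat.even_iff.2 (by omega) : Even (b + 1)).neg_one_pow, neg_neg]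
      · rw [(Nat.even_iff.2 (by omega) : Even (a + 1)).neg_one_pow,
          (Nat.odd_iff.2 (by omega) : Odd (b + 1)).neg_one_pow]
    rw [hpow]
    linear_combination (-1 : ℚ) ^ (a + 1) * this
  · intro c hc hcab
    rw [Finset.mem_range] at hc
    rw [Finsupp.single_apply, if_neg]
    intro h
    have := hne _ (by omega) (by omega) h
    omega

end Weights

namespace IsExtremalWalk

variable {V : Type*} [LinearOrder V] {G : SimpleGraph V} {L : ℕ} {w : ℕ → V}

/-- Two different pairs of positions with equal vertices are nested in one of two special ways. -/
theorem eq_or_nested (hw : IsExtremalWalk G L w) (hG : IsGapFree G) {s₁ t₁ s₂ t₂ : ℕ}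
    (h₁ : 1 ≤ s₁) (h₁' : s₁ < t₁) (ht₁ : t₁ ≤ L) (h₂ : 1 ≤ s₂) (h₂' : s₂ < t₂) (ht₂ : t₂ ≤ L)
    (h : w s₁ = w t₁) (h' : w s₂ = w t₂) :
    s₁ = s₂ ∧ t₁ = t₂ ∨
    (s₁ = 1 ∧ s₂ = 2 ∧ t₁ = t₂ + 1 ∧ t₁ % 2 = 0 ∨
      t₁ = L ∧ t₂ + 1 = L ∧ s₂ = s₁ + 1 ∧ s₂ % 2 = 0) ∨
    (s₂ = 1 ∧ s₁ = 2 ∧ t₂ = t₁ + 1 ∧ t₂ % 2 = 0 ∨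
      t₂ = L ∧ t₁ + 1 = L ∧ s₁ = s₂ + 1 ∧ s₁ % 2 = 0) := by
  rcases lt_trichotomy s₁ s₂ with hs | rfl | hs
  · rcases lt_trichotomy t₁ s₂ with ht | rfl | ht
    · exact (hw.no_disjoint_segments hG h₁ h₁' ht h₂' ht₂ h h').elim
    · exact (hw.no_three h₁ h₁' h₂' ht₂ h h').elim
    · rcases lt_trichotomy t₂ t₁ with ht' | rfl | ht'
      · exact Or.inr (Or.inl (hw.nested_segments hG h₁ hs h₂' ht' ht₁ h h'))
      · exact (hw.no_three h₁ hs ht ht₁ (h.trans h'.symm) h').elim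
      · exact (hw.no_cross h₁ hs ht ht' ht₂ h h').elim
  · rcases lt_trichotomy t₁ t₂ with ht | rfl | ht
    · exact (hw.no_three h₁ h₁' ht ht₂ h (h.symm.trans h')).elim
    · exact Or.inl ⟨rfl, rfl⟩
    · exact (hw.no_three h₁ h₂' ht ht₁ h' (h'.symm.trans h)).elim
  · rcases lt_trichotomy t₂ s₁ with ht | rfl | ht
    · exact (hw.no_disjoint_segments hG h₂ h₂' ht h₁' ht₁ h' h).elim
    · exact (hw.no_three h₂ h₂' h₁' ht₁ h' h).elim
    · rcases lt_trichotomy t₁ t₂ with ht' | rfl | ht'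
      · exact Or.inr (Or.inr (hw.nested_segments hG h₂ hs h₁' ht' ht₂ h' h))
      · exact (hw.no_three h₂ hs ht ht₂ (h'.trans h.symm) h).elim
      · exact (hw.no_cross h₂ hs ht ht' ht₁ h' h).elim

/-- Weights on the positions of an extremal walk that are balanced at all vertices and agree on
equal edges alternate in sign and have constant absolute value. -/
theorem alternating (hw : IsExtremalWalk G L w) (hG : IsGapFree G) {y : ℕ → ℚ} (hy : y L = y 0)
    (hsum : ∑ k ∈ Finset.range L,
      (Finsupp.single (w k) (y k) + Finsupp.single (w (k + 1)) (y k)) = 0)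
    (hsame : ∀ i < L, ∀ j < L, s(w i, w (i + 1)) = s(w j, w (j + 1)) → y i = y j) {k : ℕ}
    (hk : k ≤ L) : (-1) ^ k * y k = y 0 := by
  have hLL := hw.even
  replace hsum := sum_single_vertex hw.closed hy hsum
  have htotal : ∑ k ∈ Finset.Ioc 0 L, jump y k = 0 := by
    rw [sum_jump (Nat.zero_le _), (Nat.even_iff.2 hLL).neg_one_pow, hy]
    simp
  have hpair : ∀ s t, 1 ≤ s → s < t → t ≤ L → w s = w t → jump y s = jump y t := by
    intro s t hs hst ht h
    refine jump_eq_jump hsum hs hst ht (hw.parity hs hst ht h) h fun j hj hjL hjs => ?_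
    by_contra! hne
    rcases lt_trichotomy j s with h1 | h1 | h1
    · exact hw.no_three hj h1 hst ht hjs h
    · exact hne.1 h1
    rcases lt_trichotomy j t with h2 | h2 | h2
    · exact hw.no_three hs h1 h2 ht hjs.symm (hjs.trans h)
    · exact hne.2 h2
    · exact hw.no_three hs hst h2 hjL h (h.symm.trans hjs.symm)
  suffices hzero : ∀ j, 1 ≤ j → j ≤ L → jump y j = 0 by
    have h0 : ∑ j ∈ Finset.Ioc 0 k, jump y j = 0 := Finset.sum_eq_zero fun j hj => by
      rw [Finset.mem_Ioc] at hj
      exact hzero j hj.1 (hj.2.trans hk)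
    rw [sum_jump (Nat.zero_le _)] at h0
    linear_combination h0
  suffices hzero : ∀ s t, 1 ≤ s → s < t → t ≤ L → w s = w t → jump y s = 0 by
    intro j hj hjL
    by_cases h : ∃ i, 1 ≤ i ∧ i ≤ L ∧ w i = w j ∧ i ≠ j
    · obtain ⟨i, hi, hiL, hij, hne⟩ := h
      rcases lt_or_gt_of_ne hne with h1 | h1
      · rw [← hpair i j hi h1 hjL hij]
        exact hzero i j hi h1 hjL hij
      · exact hzero j i hj h1 hiL hij.symm
    · push Not at h
      exact jump_eq_zero hsum hj hjL h
  -- If only one repeated vertex is visited in an interval, and both its visits lie there, all other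
  -- jumps in the interval vanish.
  have key : ∀ a b s t, b ≤ L → a < s → s < t → t ≤ b → w s = w t →
      (∀ i j, 1 ≤ i → i < j → j ≤ L → w i = w j → i = s ∧ j = t ∨
        ((i ≤ a ∨ b < i) ∧ (j ≤ a ∨ b < j))) →
      ∑ k ∈ Finset.Ioc a b, jump y k = 2 * jump y s := by
    intro a b s t hb has hst htb h hij
    rw [Finset.sum_eq_add_of_mem s t (by simp; omega) (by simp; omega) hst.ne,
      ← hpair s t (by omega) hst (by omega) h, two_mul]
    intro c hc hcne
    rw [Finset.mem_Ioc] at hc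
    refine jump_eq_zero hsum (by omega) (by omega) fun j hj hjL hjc => ?_
    by_contra hne
    rcases lt_or_gt_of_ne hne with h1 | h1
    · have := hij j c hj h1 (by omega) hjc
      omega
    · have := hij c j (by omega) h1 (by omega) hjc.symm
      omega
  by_cases hall : ∃ s₁ t₁ s₂ t₂, 1 ≤ s₁ ∧ s₁ < s₂ ∧ s₂ < t₂ ∧ t₂ < t₁ ∧ t₁ ≤ L ∧ w s₁ = w t₁ ∧
      w s₂ = w t₂
  · obtain ⟨s₁, t₁, s₂, t₂, h₁, h₁₂, h₂, h₂', ht₁, h, h'⟩ := hall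
    have honly : ∀ i j, 1 ≤ i → i < j → j ≤ L → w i = w j →
        i = s₁ ∧ j = t₁ ∨ i = s₂ ∧ j = t₂ := by
      intro i j hi hij hj hijw
      have e1 := hw.eq_or_nested hG hi hij hj h₁ (by omega) ht₁ hijw h
      have e2 := hw.eq_or_nested hG hi hij hj (by omega) h₂ (by omega) hijw h'
      have e3 := hw.nested_segments hG h₁ h₁₂ h₂ h₂' ht₁ h h'
      have := hw.parity h₁ (by omega) ht₁ h
      have := hw.parity (by omega) h₂ (by omega) h'
      omega
    -- The same edge is traversed at the odd positions s₁ and t₂, so the signed weights there agree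
    -- and the jumps in between sum to 0.
    have hz₂ : jump y s₂ = 0 := by
      have hk2 := key s₁ t₂ s₂ t₂ (by omega) h₁₂ h₂ le_rfl h' (fun i j hi hij hj hijw => by
        have := honly i j hi hij hj hijw
        omega)
      rw [sum_jump (by omega)] at hk2
      have hp := hw.parity h₁ (by omega) ht₁ h
      rcases hw.nested_segments hG h₁ h₁₂ h₂ h₂' ht₁ h h' with ⟨rfl, rfl, rfl, h4⟩ | ⟨h5, h2, rfl, h4⟩
      · have := hsame 1 (by omega) t₂ (by omega) (by
          rw [h, h']
          exact Sym2.eq_swap)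
        rw [(Nat.odd_iff.2 (by omega) : Odd t₂).neg_one_pow, this] at hk2
        linarith
      · have := hsame s₁ (by omega) t₂ (by omega) (by
          rw [h, h', h2, ← h5]
          exact Sym2.eq_swap)
        rw [(Nat.odd_iff.2 (by omega) : Odd t₂).neg_one_pow,
          (Nat.odd_iff.2 (by omega) : Odd s₁).neg_one_pow, this] at hk2
        linarith
    have hz₁ : jump y s₁ = 0 := by
      have hin : ∑ k ∈ Finset.Ioc 0 L, jump y k = jump y s₁ + jump y t₁ := by
        refine Finset.sum_eq_add_of_mem s₁ t₁ (by simp; omega) (by simp; omega) (by omega) ?_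
        intro c hc hcne
        rw [Finset.mem_Ioc] at hc
        by_cases hc2 : c = s₂
        · rw [hc2, hz₂]
        by_cases hc3 : c = t₂
        · rw [hc3, ← hpair s₂ t₂ (by omega) h₂ (by omega) h', hz₂]
        refine jump_eq_zero hsum (by omega) (by omega) fun j hj hjL hjc => ?_
        by_contra hne
        rcases lt_or_gt_of_ne hne with h1 | h1
        · have := honly j c hj h1 (by omega) hjc
          omega
        · have := honly c j (by omega) h1 (by omega) hjc.symm
          omega
      rw [htotal, ← hpair s₁ t₁ h₁ (by omega) ht₁ h] at hin
      linarith
    intro s t hs hst ht hst'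
    rcases honly s t hs hst ht hst' with ⟨rfl, -⟩ | ⟨rfl, -⟩
    · exact hz₁
    · exact hz₂
  · intro s t hs hst ht h
    have hk := key 0 L s t le_rfl hs hst ht h (fun i j hi hij hj hijw => by
      left
      have hp := hw.parity hs hst ht h
      have hp' := hw.parity hi hij hj hijw
      rcases hw.eq_or_nested hG hi hij hj hs hst ht hijw h with h1 | h1 | h1
      · exact h1
      · exact absurd ⟨i, j, s, t, hi, by omega, hst, by omega, hj, hijw, h⟩ hall
      · exact absurd ⟨s, t, i, j, hs, by omega, hij, by omega, ht, h, hijw⟩ hall)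
    rw [htotal] at hk
    linarith

end IsExtremalWalk

end GapFree

namespace GapFree

/-! ### Edge exponents and the reverse lexicographic order. -/

section EdgeExponent

variable {V : Type*}

theorem edgeExponent_mk (a b : V) :
    edgeExponent s(a, b) = Finsupp.single a 1 + Finsupp.single b 1 := rfl

theorem edgeExponent_apply_ne_zero {e : Sym2 V} {x : V} : edgeExponent e x ≠ 0 ↔ x ∈ e := by
  classical
  induction e with
  | h a b =>
    simp only [edgeExponent_mk, Finsupp.add_apply, Finsupp.single_apply, Sym2.mem_iff]
    split_ifs <;> grind

theorem degree_edgeExponent (e : Sym2 V) : (edgeExponent e).degree = 2 := by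
  induction e with
  | h a b => simp [edgeExponent_mk, map_add]

theorem edgeExponent_ne_zero (e : Sym2 V) : edgeExponent e ≠ 0 := by
  intro h
  simpa [h] using degree_edgeExponent e

/-- The deciding index is an end of the smaller monomial, and beyond it the exponents agree, so c
and d cannot reach beyond max a b. -/
theorem GrevlexLT.max_le_max [LinearOrder V] {a b c d : V}
    (h : GrevlexLT (edgeExponent s(a, b)) (edgeExponent s(c, d))) : max c d ≤ max a b := by
  rw [GrevlexLT, degree_edgeExponent, degree_edgeExponent] at h
  obtain ⟨-, i, hi, hj⟩ := h.resolve_left (lt_irrefl _)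
  by_contra! hlt
  have hi' : i ∈ s(a, b) := edgeExponent_apply_ne_zero.1 (by omega)
  have hile : i ≤ max a b := by
    rcases Sym2.mem_iff.1 hi' with rfl | rfl
    · exact le_max_left _ _
    · exact le_max_right _ _
  have hM : max c d ∈ s(c, d) := by
    rcases max_choice c d with h | h <;> simp [h]
  rw [← edgeExponent_apply_ne_zero, ← hj _ (hile.trans_lt hlt), edgeExponent_apply_ne_zero] at hM
  rcases Sym2.mem_iff.1 hM with h | h <;> rw [h] at hlt <;> simp at hlt

end EdgeExponent

/-! ### Alternating walks through a balanced pair of exponents. -/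

section WalkEdges

variable {ι V : Type*}

/-- The exponent vector of the edges of a walk at those positions in `T` that are congruent to `q`
modulo `2`, where `c k` is the index of the edge at position `k`. -/
noncomputable def edgesAt (c : ℕ → ι) (q : ℕ) (T : Finset ℕ) : ι →₀ ℕ :=
  ∑ k ∈ T with k % 2 = q, Finsupp.single (c k) 1

variable {c : ℕ → ι} {T R : Finset ℕ}

theorem edgesAt_mono (h : T ⊆ R) (q : ℕ) : edgesAt c q T ≤ edgesAt c q R :=
  Finset.sum_le_sum_of_subset (Finset.filter_subset_filter _ h)

theorem single_le_edgesAt {k : ℕ} (h : k ∈ T) :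
    Finsupp.single (c k) 1 ≤ edgesAt c (k % 2) T :=
  Finset.single_le_sum (f := fun k => Finsupp.single (c k) 1) (fun _ _ => zero_le)
    (Finset.mem_filter.2 ⟨h, rfl⟩)

theorem edgesAt_insert_same {k : ℕ} (h : k ∉ T) :
    edgesAt c (k % 2) (insert k T) = Finsupp.single (c k) 1 + edgesAt c (k % 2) T := by
  rw [edgesAt, Finset.filter_insert, if_pos rfl, Finset.sum_insert (by simp [h]), edgesAt]

theorem edgesAt_insert_of_ne {k q : ℕ} (h : k % 2 ≠ q) :
    edgesAt c q (insert k T) = edgesAt c q T := by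
  rw [edgesAt, Finset.filter_insert, if_neg h, edgesAt]

theorem edgesAt_congr {c' : ℕ → ι} (h : ∀ k ∈ T, c k = c' k) (q : ℕ) :
    edgesAt c q T = edgesAt c' q T :=
  Finset.sum_congr rfl fun k hk => by rw [h k (Finset.mem_filter.1 hk).1]

theorem mem_of_edgesAt_eq {k : ℕ} (hTR : T ⊆ R) (hk : k ∈ R)
    (h : edgesAt c (k % 2) T = edgesAt c (k % 2) R) : k ∈ T := by
  by_contra hkT
  have := edgesAt_mono (c := c) (Finset.insert_subset hk hTR) (k % 2)
  rw [edgesAt_insert_same hkT, ← h] at this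
  have := this (c k)
  simp at this

theorem edgesAt_apply [DecidableEq ι] (q : ℕ) (i : ι) :
    edgesAt c q T i = ({k ∈ T | k % 2 = q ∧ c k = i} : Finset ℕ).card := by
  rw [edgesAt, Finsupp.finsetSum_apply, ← Finset.filter_filter, Finset.card_filter]
  exact Finset.sum_congr rfl fun k _ => by rw [Finsupp.single_apply]

/-- Natural exponent vectors as vectors over a ring. -/
noncomputable def castExponent (A : Type*) [NonAssocSemiring A] : (V →₀ ℕ) →+ (V →₀ A) :=
  Finsupp.mapRange.addMonoidHom (Nat.castAddMonoidHom A)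

theorem castExponent_apply {A : Type*} [NonAssocSemiring A] (a : V →₀ ℕ) (x : V) :
    castExponent A a x = (a x : A) := by
  simp [castExponent]

theorem castExponent_single {A : Type*} [NonAssocSemiring A] (x : V) (n : ℕ) :
    castExponent A (Finsupp.single x n) = Finsupp.single x (n : A) := by
  simp [castExponent]

theorem castExponent_injective : Function.Injective (castExponent ℤ : (V →₀ ℕ) →+ (V →₀ ℤ)) := by
  intro a b h
  ext x
  have := DFunLike.congr_fun h x
  rw [castExponent_apply, castExponent_apply] at this
  exact_mod_cast this

variable {p : ι → Sym2 V} {w : ℕ → V}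

theorem castExponent_edgesAt (hc : ∀ k ∈ T, p (c k) = s(w k, w (k + 1))) (q : ℕ) :
    castExponent ℤ (Finsupp.linearCombination ℕ (fun i => edgeExponent (p i)) (edgesAt c q T)) =
      ∑ k ∈ T with k % 2 = q, (Finsupp.single (w k) 1 + Finsupp.single (w (k + 1)) 1) := by
  rw [edgesAt, map_sum, map_sum]
  refine Finset.sum_congr rfl fun k hk => ?_
  rw [Finsupp.linearCombination_single, one_smul, hc k (Finset.mem_filter.1 hk).1, edgeExponent_mk,
    map_add, castExponent_single, castExponent_single, Nat.cast_one]

theorem castExponent_sub_eq_excess (hc : ∀ k ∈ T, p (c k) = s(w k, w (k + 1))) :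
    castExponent ℤ (Finsupp.linearCombination ℕ (fun i => edgeExponent (p i)) (edgesAt c 0 T)) -
      castExponent ℤ (Finsupp.linearCombination ℕ (fun i => edgeExponent (p i)) (edgesAt c 1 T)) =
      excess w T := by
  rw [castExponent_edgesAt hc, castExponent_edgesAt hc, excess, Finset.sum_filter,
    Finset.sum_filter, ← Finset.sum_sub_distrib]
  refine Finset.sum_congr rfl fun k _ => ?_
  rcases Nat.mod_two_eq_zero_or_one k with h | h
  · rw [if_pos h, if_neg (by omega), signedVertex_of_even h, signedVertex_of_odd (by omega)]
    abel
  · rw [if_neg (by omega), if_pos h, signedVertex_of_odd h, signedVertex_of_even (by omega)]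
    abel

theorem exists_edge_of_lt {a v : ι →₀ ℕ} {x : V} (hav : a ≤ v)
    (h : Finsupp.linearCombination ℕ (fun i => edgeExponent (p i)) a x <
      Finsupp.linearCombination ℕ (fun i => edgeExponent (p i)) v x) :
    ∃ i y, Finsupp.single i 1 + a ≤ v ∧ p i = s(x, y) := by
  obtain ⟨b, rfl⟩ := exists_add_of_le hav
  rw [map_add, Finsupp.add_apply, lt_add_iff_pos_right, Finsupp.linearCombination_apply,
    Finsupp.sum, Finsupp.finsetSum_apply] at h
  obtain ⟨i, hi, hne⟩ := Finset.exists_ne_zero_of_sum_ne_zero h.ne'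
  rw [Finsupp.smul_apply, smul_eq_mul] at hne
  obtain ⟨y, hy⟩ := edgeExponent_apply_ne_zero.1 (right_ne_zero_of_mul hne)
  refine ⟨i, y, ?_, hy⟩
  rw [add_comm]
  refine add_le_add_right ?_ a
  rw [Finsupp.single_le_iff]
  exact Nat.one_le_iff_ne_zero.2 (left_ne_zero_of_mul hne)

/-- An alternating walk of length `n` that starts with the edge `i₀`, and uses edges of `u` at even
and edges of `v` at odd positions. -/
structure IsAlternatingWalk (p : ι → Sym2 V) (u v : ι →₀ ℕ) (i₀ : ι) (n : ℕ) (w : ℕ → V)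
    (c : ℕ → ι) : Prop where
  first : c 0 = i₀
  edge : ∀ k < n, p (c k) = s(w k, w (k + 1))
  even_le : edgesAt c 0 (Finset.range n) ≤ u
  odd_le : edgesAt c 1 (Finset.range n) ≤ v

theorem IsAlternatingWalk.extend {u v : ι →₀ ℕ} {i₀ i : ι} {n : ℕ}
    (h : IsAlternatingWalk p u v i₀ n w c) (hn : 1 ≤ n) {y : V} (hy : p i = s(w n, y))
    (hi : Finsupp.single i 1 + edgesAt c (n % 2) (Finset.range n) ≤ if n % 2 = 0 then u else v) :
    ∃ w' c', IsAlternatingWalk p u v i₀ (n + 1) w' c' := by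
  refine ⟨Function.update w (n + 1) y, Function.update c n i, ?_, ?_, ?_, ?_⟩
  · rw [Function.update_of_ne (by omega), h.first]
  · intro k hk
    rcases (Nat.lt_succ_iff.1 hk).eq_or_lt with rfl | hk
    · rw [Function.update_self, Function.update_self, Function.update_of_ne (by omega), hy]
    · rw [Function.update_of_ne (by omega), Function.update_of_ne (by omega),
        Function.update_of_ne (by omega), h.edge k hk]
  all_goals
    have hcongr : ∀ q, edgesAt (Function.update c n i) q (Finset.range n) =
        edgesAt c q (Finset.range n) := edgesAt_congr fun k hk => by
      rw [Function.update_of_ne (Finset.mem_range.1 hk).ne]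
    have hsame := edgesAt_insert_same (c := Function.update c n i) (k := n) (T := Finset.range n)
      Finset.notMem_range_self
    rw [Function.update_self, hcongr] at hsame
    rw [Finset.range_add_one]
    rcases Nat.mod_two_eq_zero_or_one n with h0 | h0
  · rw [h0] at hsame hi
    rw [hsame]
    simpa using hi
  · rw [edgesAt_insert_of_ne (by omega), hcongr]
    exact h.even_le
  · rw [edgesAt_insert_of_ne (by omega), hcongr]
    exact h.odd_le
  · rw [h0] at hsame hi
    rw [hsame]
    simpa using hi

theorem IsAlternatingWalk.length_le {u v : ι →₀ ℕ} {i₀ : ι} {n : ℕ}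
    (h : IsAlternatingWalk p u v i₀ n w c) : n ≤ u.degree + v.degree := by
  have h0 := Finsupp.degree_mono h.even_le
  have h1 := Finsupp.degree_mono h.odd_le
  simp only [edgesAt, map_sum, Finsupp.degree_single, Finset.sum_const, smul_eq_mul, mul_one]
    at h0 h1
  have hcard := Finset.card_filter_add_card_filter_not (s := Finset.range n) (fun k => k % 2 = 0)
  have hodd : ({k ∈ Finset.range n | ¬ k % 2 = 0} : Finset ℕ) =
      {k ∈ Finset.range n | k % 2 = 1} := by
    ext k
    simp
  rw [hodd, Finset.card_range] at hcard
  omega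

/-- As long as the walk has not closed up at an even length, the kind of edge due next is used less
often at its last vertex than the other kind. As u and v have equal vertex degrees, an unused edge
of that kind is left there. The length is bounded, so this has to stop. -/
theorem exists_closed_alternatingWalk {u v : ι →₀ ℕ} {i₀ : ι} (hi₀ : u i₀ ≠ 0)
    (h : Finsupp.linearCombination ℕ (fun i => edgeExponent (p i)) u =
      Finsupp.linearCombination ℕ (fun i => edgeExponent (p i)) v) :
    ∃ L w c, 0 < L ∧ L % 2 = 0 ∧ w L = w 0 ∧ IsAlternatingWalk p u v i₀ L w c := by
  by_contra hcon
  suffices H : ∀ n, 1 ≤ n → ∃ w c, IsAlternatingWalk p u v i₀ n w c by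
    obtain ⟨w, c, hwc⟩ := H (u.degree + v.degree + 1) (by omega)
    have := hwc.length_le
    omega
  intro n hn
  induction n, hn using Nat.le_induction with
  | base =>
    obtain ⟨a, b, hab⟩ : ∃ a b, p i₀ = s(a, b) := by
      induction hp : p i₀ with
      | h a b => exact ⟨a, b, rfl⟩
    refine ⟨fun k => if k = 0 then a else b, fun _ => i₀, rfl, ?_, ?_, ?_⟩
    · intro k hk
      obtain rfl : k = 0 := by omega
      simpa using hab
    · simpa [edgesAt, Finset.filter_singleton, Nat.one_le_iff_ne_zero] using hi₀
    · simp [edgesAt, Finset.filter_singleton]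
  | succ n hn ih =>
    obtain ⟨w, c, hwc⟩ := ih
    have hx := castExponent_sub_eq_excess (p := p) (c := c) (w := w) (T := Finset.range n)
      (fun k hk => hwc.edge k (Finset.mem_range.1 hk))
    rw [Finset.range_eq_Ico, excess_Ico (Nat.zero_le _), signedVertex_of_even (k := 0) rfl] at hx
    replace hx := DFunLike.congr_fun hx (w n)
    simp only [Finsupp.sub_apply, castExponent_apply] at hx
    have mono : ∀ {a b : ι →₀ ℕ}, a ≤ b →
        Finsupp.linearCombination ℕ (fun i => edgeExponent (p i)) a (w n) ≤
        Finsupp.linearCombination ℕ (fun i => edgeExponent (p i)) b (w n) := by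
      intro a b hab
      obtain ⟨d, rfl⟩ := exists_add_of_le hab
      simp
    have h0 := mono hwc.even_le
    have h1 := mono hwc.odd_le
    rw [Finset.range_eq_Ico] at h0 h1
    rcases Nat.mod_two_eq_zero_or_one n with hn2 | hn2
    · have hne : w n ≠ w 0 := fun hw => hcon ⟨n, w, c, hn, hn2, hw, hwc⟩
      rw [signedVertex_of_even hn2, Finsupp.single_eq_same,
        Finsupp.single_eq_of_ne hne] at hx
      obtain ⟨i, y, hi, hy⟩ := exists_edge_of_lt (p := p) (x := w n) hwc.even_le (by
        rw [Finset.range_eq_Ico]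
        rw [h] at h0 ⊢
        omega)
      exact hwc.extend hn hy (by rwa [hn2, if_pos rfl])
    · have hnn : 0 ≤ (Finsupp.single (w 0) 1 : V →₀ ℤ) (w n) := by
        classical
        rw [Finsupp.single_apply]
        split_ifs <;> simp
      rw [signedVertex_of_odd hn2, Finsupp.neg_apply, Finsupp.single_eq_same] at hx
      obtain ⟨i, y, hi, hy⟩ := exists_edge_of_lt (p := p) (x := w n) hwc.odd_le (by
        rw [Finset.range_eq_Ico]
        rw [h] at h0
        omega)
      exact hwc.extend hn hy (by rwa [hn2, if_neg one_ne_zero])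

end WalkEdges

end GapFree

namespace GapFree

open MvPolynomial

/-! ### Variables of toric binomials. -/

section Toric

variable {K : Type*} [Field K] {ι σ : Type*}

theorem mem_vars_monomial_sub_monomial {u v : ι →₀ ℕ} (h : u ≠ v) {i : ι} :
    i ∈ (monomial u 1 - monomial v 1 : MvPolynomial ι K).vars ↔ u i ≠ 0 ∨ v i ≠ 0 := by
  classical
  simp only [mem_vars_iff_mem_support, mem_support_iff, coeff_sub, coeff_monomial]
  constructor
  · rintro ⟨d, hd, hi⟩
    by_cases hu : u = d
    · subst hu
      exact Or.inl (Finsupp.mem_support_iff.1 hi)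
    by_cases hv : v = d
    · subst hv
      exact Or.inr (Finsupp.mem_support_iff.1 hi)
    simp [hu, hv] at hd
  · rintro (hi | hi)
    · exact ⟨u, by simp [h.symm], Finsupp.mem_support_iff.2 hi⟩
    · exact ⟨v, by simp [h], Finsupp.mem_support_iff.2 hi⟩

theorem disjoint_of_minimal {τ : MonomialOrder ι} {p : ι → σ →₀ ℕ} {u v : ι →₀ ℕ}
    (hp : ∀ i, p i ≠ 0) (hu : Minimal (· ∈ nonstandard τ p) u) (hv : v ∉ nonstandard τ p)
    (h : Finsupp.linearCombination ℕ p v = Finsupp.linearCombination ℕ p u) (i : ι) :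
    u i = 0 ∨ v i = 0 := by
  by_contra! hne
  rcases primitive_of_minimal (u' := Finsupp.single i 1) (v' := Finsupp.single i 1) hp hu hv h
    (Finsupp.single_le_iff.2 (Nat.one_le_iff_ne_zero.2 hne.1))
    (Finsupp.single_le_iff.2 (Nat.one_le_iff_ne_zero.2 hne.2)) rfl with ⟨h1, -⟩ | ⟨h1, h2⟩
  · simp at h1
  · exact hv (h2 ▸ h1 ▸ hu.1)

end Toric

/-! ### From Gröbner basis elements to extremal walks, and back to circuits. -/

section Graph

variable {V : Type*} [LinearOrder V] {G : SimpleGraph V} {m : ℕ} {e : Fin m ≃ G.edgeSet}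

theorem max_le_max_of_le
    (he : ∀ i j : Fin m, i < j →
      GrevlexLT (edgeExponent (e j : Sym2 V)) (edgeExponent (e i : Sym2 V)))
    {i j : Fin m} (hij : i ≤ j) {a b x y : V} (hi : (e i : Sym2 V) = s(a, b))
    (hj : (e j : Sym2 V) = s(x, y)) : max a b ≤ max x y := by
  rcases hij.eq_or_lt with rfl | hij
  · rcases Sym2.eq_iff.1 (hi.symm.trans hj) with ⟨rfl, rfl⟩ | ⟨rfl, rfl⟩
    · exact le_rfl
    · exact (max_comm _ _).le
  · have := he i j hij
    rw [hi, hj] at this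
    exact this.max_le_max

/-- A binomial of the reduced Gröbner basis is traversed by an extremal walk. -/
theorem exists_extremalWalk
    (he : ∀ i j : Fin m, i < j →
      GrevlexLT (edgeExponent (e j : Sym2 V)) (edgeExponent (e i : Sym2 V)))
    {u v : Fin m →₀ ℕ}
    (hu : Minimal (· ∈ nonstandard MonomialOrder.lex fun i => edgeExponent (e i : Sym2 V)) u)
    (hv : v ∉ nonstandard MonomialOrder.lex fun i => edgeExponent (e i : Sym2 V))
    (h : Finsupp.linearCombination ℕ (fun i => edgeExponent (e i : Sym2 V)) v =
      Finsupp.linearCombination ℕ (fun i => edgeExponent (e i : Sym2 V)) u) :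
    ∃ (L : ℕ) (w : ℕ → V) (c : ℕ → Fin m), IsExtremalWalk G L w ∧
      (∀ k < L, (e (c k) : Sym2 V) = s(w k, w (k + 1))) ∧
      edgesAt c 0 (Finset.range L) = u ∧ edgesAt c 1 (Finset.range L) = v := by
  have hp : ∀ i : Fin m, edgeExponent (e i : Sym2 V) ≠ 0 := fun i => edgeExponent_ne_zero _
  have hdisj := disjoint_of_minimal hp hu hv h
  -- The first index where u and v differ. As their supports are disjoint, it is the first variable
  -- of the whole binomial and occurs only in u.
  obtain ⟨i₀, hlt, hi₀⟩ := Finsupp.Lex.lt_iff.1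
    (MonomialOrder.lex_lt_iff.1 (lt_of_notMem_nonstandard hu.1 hv h))
  simp only [ofLex_toLex] at hlt hi₀
  have hvi₀ : v i₀ = 0 := (hdisj i₀).resolve_left (by omega)
  have hzero : ∀ i < i₀, u i = 0 ∧ v i = 0 := fun i hi => by
    have := hlt i hi
    have := hdisj i
    omega
  obtain ⟨L, w, c, hL, hL2, hwL, hwalk⟩ := exists_closed_alternatingWalk
    (p := fun i => (e i : Sym2 V)) (i₀ := i₀) (by omega) h.symm
  have hedge : ∀ T ⊆ Finset.range L, ∀ k ∈ T, (e (c k) : Sym2 V) = s(w k, w (k + 1)) :=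
    fun T hT k hk => hwalk.edge k (Finset.mem_range.1 (hT hk))
  have h0mem : 0 ∈ Finset.range L := Finset.mem_range.2 hL
  have hle : ∀ k < L, i₀ ≤ c k := by
    intro k hk
    by_contra! hlt
    have h1 := single_le_edgesAt (c := c) (Finset.mem_range.2 hk) (c k)
    have h2 := hwalk.even_le (c k)
    have h3 := hwalk.odd_le (c k)
    have h4 := hzero _ hlt
    rw [Finsupp.single_eq_same] at h1
    rcases Nat.mod_two_eq_zero_or_one k with hk2 | hk2 <;> rw [hk2] at h1 <;> omega
  have hprim : ∀ T ⊆ Finset.range L, excess w T = 0 →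
      (edgesAt c 0 T = 0 ∧ edgesAt c 1 T = 0) ∨ (edgesAt c 0 T = u ∧ edgesAt c 1 T = v) := by
    intro T hT hx
    refine primitive_of_minimal hp hu hv h ((edgesAt_mono hT 0).trans hwalk.even_le)
      ((edgesAt_mono hT 1).trans hwalk.odd_le) ?_
    rw [← castExponent_sub_eq_excess (p := fun i => (e i : Sym2 V)) (hedge T hT), sub_eq_zero]
      at hx
    exact (castExponent_injective hx).symm
  have hpos : ∀ T : Finset ℕ, 0 ∈ T → 1 ≤ edgesAt c 0 T i₀ := by
    intro T hT
    have := single_le_edgesAt (c := c) hT i₀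
    rwa [hwalk.first, Finsupp.single_eq_same] at this
  have hfull : edgesAt c 0 (Finset.range L) = u ∧ edgesAt c 1 (Finset.range L) = v := by
    refine (hprim _ subset_rfl ?_).resolve_left fun h0 => ?_
    · rw [Finset.range_eq_Ico, excess_Ico (Nat.zero_le _), signedVertex_of_even hL2,
        signedVertex_of_even (k := 0) rfl, hwL, sub_self]
    · have := hpos _ h0mem
      rw [h0.1] at this
      simp at this
  refine ⟨L, w, c, ⟨hL, hL2, hwL, ?_, ?_, ?_, ?_⟩, hwalk.edge, hfull⟩
  · intro k hk
    rw [← SimpleGraph.mem_edgeSet, ← hwalk.edge k hk]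
    exact (e (c k)).2
  · intro k hk
    exact max_le_max_of_le he (i := c 0) (hwalk.first ▸ hle k hk) (hwalk.edge 0 hL)
      (hwalk.edge k hk)
  · intro T hT hx
    rcases hprim T hT hx with ⟨h0, h1⟩ | ⟨h0, h1⟩
    · left
      rw [Finset.eq_empty_iff_forall_notMem]
      intro k hk
      have := single_le_edgesAt (c := c) hk (c k)
      rcases Nat.mod_two_eq_zero_or_one k with hk2 | hk2 <;> rw [hk2] at this
      · simp [h0] at this
      · simp [h1] at this
    · right
      refine hT.antisymm fun k hk => ?_
      refine mem_of_edgesAt_eq (c := c) hT hk ?_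
      rcases Nat.mod_two_eq_zero_or_one k with hk2 | hk2 <;> rw [hk2]
      · rw [h0, hfull.1]
      · rw [h1, hfull.2]
  · intro T hT h0T x y hxy hlow hx k hk hk2
    have hw0 : (e i₀ : Sym2 V) = s(w 0, w 1) := hwalk.first ▸ hwalk.edge 0 hL
    -- An end above the bound makes xy come later in the order. An edge at an odd position belongs
    -- to v, hence is not i₀.
    obtain ⟨j, hj, hlt⟩ : ∃ j, (e j : Sym2 V) = s(x, y) ∧ i₀ < j := by
      rw [← or_assoc] at hlow
      rcases hlow with hlow | ⟨k, hk, hk2, rfl, rfl⟩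
      · refine ⟨e.symm ⟨s(x, y), hxy⟩, by simp, ?_⟩
        by_contra! hle
        have := max_le_max_of_le he hle (a := x) (b := y) (by simp) hw0
        rcases hlow with h | h
        · exact absurd ((le_max_left x y).trans this) (not_le.2 h)
        · exact absurd ((le_max_right x y).trans this) (not_le.2 h)
      · refine ⟨c k, hwalk.edge k hk, lt_of_le_of_ne (hle k hk) ?_⟩
        intro hck
        have := single_le_edgesAt (c := c) (Finset.mem_range.2 hk) i₀
        rw [hk2, hfull.2, hvi₀, ← hck, Finsupp.single_eq_same] at this
        omega
    -- The odd part of T together with xy has the same image and involves no variable up to i₀,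
    -- while the even part involves i₀; so it is lexicographically smaller.
    have hmem : edgesAt c 0 T ∈
        nonstandard MonomialOrder.lex fun i => edgeExponent (e i : Sym2 V) := by
      refine ⟨edgesAt c 1 T + Finsupp.single j 1, ?_, ?_⟩
      · rw [MonomialOrder.lex_lt_iff, Finsupp.Lex.lt_iff]
        have hv' := fun i => (edgesAt_mono (c := c) hT 1).trans hwalk.odd_le i
        have hu' := fun i => (edgesAt_mono (c := c) hT 0).trans hwalk.even_le i
        refine ⟨i₀, fun i hi => ?_, ?_⟩
        · have h1 := hv' i
          have h2 := hu' i
          rw [(hzero i hi).2] at h1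
          rw [(hzero i hi).1] at h2
          simp only [ofLex_toLex, Finsupp.add_apply,
            Finsupp.single_eq_of_ne (hi.trans hlt).ne]
          omega
        · have h1 := hv' i₀
          have h2 := hpos T h0T
          rw [hvi₀] at h1
          simp only [ofLex_toLex, Finsupp.add_apply, Finsupp.single_eq_of_ne hlt.ne]
          omega
      · apply castExponent_injective
        rw [← castExponent_sub_eq_excess (p := fun i => (e i : Sym2 V)) (hedge T hT)] at hx
        rw [map_add, map_add, Finsupp.linearCombination_single, one_smul, hj, edgeExponent_mk,
          map_add, castExponent_single, castExponent_single, Nat.cast_one, ← hx]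
        abel
    have hle' := hu.2 hmem ((edgesAt_mono hT 0).trans hwalk.even_le)
    refine mem_of_edgesAt_eq (c := c) hT (Finset.mem_range.2 hk) ?_
    rw [hk2]
    exact (edgesAt_mono hT 0).antisymm (hfull.1 ▸ hle')

theorem squarefree_of_minimal (hG : IsGapFree G)
    (he : ∀ i j : Fin m, i < j →
      GrevlexLT (edgeExponent (e j : Sym2 V)) (edgeExponent (e i : Sym2 V)))
    {u : Fin m →₀ ℕ}
    (hu : Minimal (· ∈ nonstandard MonomialOrder.lex fun i => edgeExponent (e i : Sym2 V)) u)
    (i : Fin m) : u i ≤ 1 := by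
  obtain ⟨v, hv, h⟩ := exists_notMem_nonstandard (τ := MonomialOrder.lex)
    (p := fun i => edgeExponent (e i : Sym2 V)) u
  obtain ⟨L, w, c, hw, hc, rfl, -⟩ := exists_extremalWalk he hu hv h
  rw [edgesAt_apply, Finset.card_le_one]
  intro a ha b hb
  simp only [Finset.mem_filter, Finset.mem_range] at ha hb
  have hab : s(w a, w (a + 1)) = s(w b, w (b + 1)) := by
    rw [← hc a ha.1, ← hc b hb.1, ha.2.2, hb.2.2]
  rcases lt_trichotomy a b with hlt | rfl | hlt
  · exact absurd hab (hw.even_edge_injective hG hlt hb.1 ha.2.1 hb.2.1)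
  · rfl
  · exact absurd hab.symm (hw.even_edge_injective hG hlt ha.1 hb.2.1 ha.2.1)

/-- A relation u' - v' supported on the walk puts balanced weights on its positions, which have
constant absolute value by `alternating`. A missing variable makes one of them, hence all, vanish.
-/
theorem not_vars_ssubset (K : Type*) [Field K] (hG : IsGapFree G)
    (he : ∀ i j : Fin m, i < j →
      GrevlexLT (edgeExponent (e j : Sym2 V)) (edgeExponent (e i : Sym2 V)))
    {u v : Fin m →₀ ℕ}
    (hu : Minimal (· ∈ nonstandard MonomialOrder.lex fun i => edgeExponent (e i : Sym2 V)) u)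
    (hv : v ∉ nonstandard MonomialOrder.lex fun i => edgeExponent (e i : Sym2 V))
    (h : Finsupp.linearCombination ℕ (fun i => edgeExponent (e i : Sym2 V)) v =
      Finsupp.linearCombination ℕ (fun i => edgeExponent (e i : Sym2 V)) u)
    {u' v' : Fin m →₀ ℕ} (hne : u' ≠ v')
    (h' : Finsupp.linearCombination ℕ (fun i => edgeExponent (e i : Sym2 V)) u' =
      Finsupp.linearCombination ℕ (fun i => edgeExponent (e i : Sym2 V)) v') :
    ¬ (monomial u' 1 - monomial v' 1 : MvPolynomial (Fin m) K).vars ⊂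
      (monomial u 1 - monomial v 1 : MvPolynomial (Fin m) K).vars := by
  intro hss
  have huv : u ≠ v := fun huv => hv (huv ▸ hu.1)
  have hsub := hss.subset
  obtain ⟨j, hj, hj'⟩ := Finset.exists_of_ssubset hss
  obtain ⟨L, w, c, hw, hc, hcu, hcv⟩ := exists_extremalWalk he hu hv h
  have hpos : ∀ i, i ∈ (monomial u 1 - monomial v 1 : MvPolynomial (Fin m) K).vars →
      ∃ k < L, c k = i := by
    intro i hi
    rw [mem_vars_monomial_sub_monomial huv, ← hcu, ← hcv, edgesAt_apply, edgesAt_apply,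
      Finset.card_ne_zero, Finset.card_ne_zero] at hi
    rcases hi with ⟨k, hk⟩ | ⟨k, hk⟩ <;> simp only [Finset.mem_filter, Finset.mem_range] at hk
    · exact ⟨k, hk.1, hk.2.2⟩
    · exact ⟨k, hk.1, hk.2.2⟩
  let z : Fin m → ℚ := fun i => (u' i : ℚ) - v' i
  have hz : ∀ i, i ∉ (monomial u' 1 - monomial v' 1 : MvPolynomial (Fin m) K).vars → z i = 0 := by
    intro i hi
    rw [mem_vars_monomial_sub_monomial hne] at hi
    push Not at hi
    simp [z, hi.1, hi.2]
  let n : Fin m → ℕ := fun i => ({k ∈ Finset.range L | c k = i} : Finset ℕ).card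
  have hn : ∀ k < L, (n (c k) : ℚ) ≠ 0 := by
    intro k hk
    rw [Nat.cast_ne_zero, Finset.card_ne_zero]
    exact ⟨k, by simp [hk]⟩
  -- An edge may be traversed several times; its weight is shared equally among its positions, as
  -- `alternating` requires.
  let f : Fin m → ℚ := fun i => z i / n i
  -- Reduction modulo L gives y L = y 0, whatever `c L` is.
  let y : ℕ → ℚ := fun k => f (c (k % L))
  have hy : ∀ k < L, y k = f (c k) := fun k hk => by simp only [y, Nat.mod_eq_of_lt hk]
  have hsum : ∑ k ∈ Finset.range L,
      (Finsupp.single (w k) (y k) + Finsupp.single (w (k + 1)) (y k)) = 0 := by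
    have h1 : ∀ k ∈ Finset.range L,
        Finsupp.single (w k) (y k) + Finsupp.single (w (k + 1)) (y k) =
          f (c k) • castExponent ℚ (edgeExponent (e (c k) : Sym2 V)) := by
      intro k hk
      rw [hc k (Finset.mem_range.1 hk), hy k (Finset.mem_range.1 hk), edgeExponent_mk, map_add,
        castExponent_single, castExponent_single, smul_add, Finsupp.smul_single,
        Finsupp.smul_single]
      simp
    have h2 : ∀ i, n i • (f i • castExponent ℚ (edgeExponent (e i : Sym2 V))) =
        z i • castExponent ℚ (edgeExponent (e i : Sym2 V)) := by
      intro i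
      rw [← Nat.cast_smul_eq_nsmul ℚ, smul_smul]
      by_cases hi : i ∈ (monomial u 1 - monomial v 1 : MvPolynomial (Fin m) K).vars
      · obtain ⟨k, hk, rfl⟩ := hpos i hi
        rw [mul_div_cancel₀ _ (hn k hk)]
      · simp [f, hz i fun h => hi (hsub h)]
    rw [Finset.sum_congr rfl h1, ← Finset.sum_fiberwise (g := c)]
    have h3 : ∀ i ∈ (Finset.univ : Finset (Fin m)), ∑ k ∈ Finset.range L with c k = i,
        f (c k) • castExponent ℚ (edgeExponent (e (c k) : Sym2 V)) =
          z i • castExponent ℚ (edgeExponent (e i : Sym2 V)) := by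
      intro i _
      rw [← h2, ← Finset.sum_const]
      exact Finset.sum_congr rfl fun k hk => by rw [(Finset.mem_filter.1 hk).2]
    rw [Finset.sum_congr rfl h3]
    have h4 : ∀ a : Fin m →₀ ℕ, castExponent ℚ
        (Finsupp.linearCombination ℕ (fun i => edgeExponent (e i : Sym2 V)) a) =
          ∑ i, (a i : ℚ) • castExponent ℚ (edgeExponent (e i : Sym2 V)) := by
      intro a
      rw [Finsupp.linearCombination_apply, Finsupp.sum_fintype _ _ (by simp), map_sum]
      exact Finset.sum_congr rfl fun i _ => by rw [map_nsmul, Nat.cast_smul_eq_nsmul]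
    simp only [z, sub_smul, Finset.sum_sub_distrib]
    rw [← h4, ← h4, h', sub_self]
  have halt : ∀ k ≤ L, (-1) ^ k * y k = y 0 := fun k hk =>
    hw.alternating hG (by simp [y]) hsum (fun a ha b hb hab => by
      rw [hy a ha, hy b hb, e.injective (Subtype.ext ((hc a ha).trans (hab.trans (hc b hb).symm)))])
      hk
  obtain ⟨k, hk, rfl⟩ := hpos j hj
  have hy0 : y 0 = 0 := by
    rw [← halt k hk.le, hy k hk]
    simp [f, hz _ hj']
  have hz0 : ∀ i, z i = 0 := by
    intro i
    by_cases hi : i ∈ (monomial u 1 - monomial v 1 : MvPolynomial (Fin m) K).vars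
    · obtain ⟨k, hk, rfl⟩ := hpos i hi
      have := halt k hk.le
      rw [hy0, hy k hk] at this
      simpa [f, hn k hk] using this
    · exact hz i fun h => hi (hsub h)
  refine hne (Finsupp.ext fun i => ?_)
  have := sub_eq_zero.1 (hz0 i)
  exact_mod_cast this

end Graph

end GapFree

theorem theorem3p5 {K : Type*} [Field K] {V : Type*} [Fintype V] [LinearOrder V]
    (G : SimpleGraph V) (hG : GapFree.IsGapFree G) (m : ℕ) (e : Fin m ≃ G.edgeSet)
    (he : ∀ i j : Fin m, i < j →
      GapFree.GrevlexLT (GapFree.edgeExponent (e j : Sym2 V))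
        (GapFree.edgeExponent (e i : Sym2 V))) :
    (∃ S : Set (MvPolynomial (Fin m) K), (∀ s ∈ S, GapFree.IsSquarefreeMonomial s) ∧
      GapFree.initialIdeal MonomialOrder.lex (GapFree.toricIdeal K e) = Ideal.span S) ∧
    (∃ 𝒢 : Set (MvPolynomial (Fin m) K),
      GapFree.IsReducedGroebnerBasis MonomialOrder.lex (GapFree.toricIdeal K e) 𝒢 ∧
      (∀ ℋ : Set (MvPolynomial (Fin m) K),
        GapFree.IsReducedGroebnerBasis MonomialOrder.lex (GapFree.toricIdeal K e) ℋ → ℋ = 𝒢) ∧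
      ∀ g ∈ 𝒢, GapFree.IsCircuit (GapFree.toricIdeal K e) g) := by
  have hI : GapFree.toricIdeal K e =
      GapFree.expKer K fun i => GapFree.edgeExponent (e i : Sym2 V) := rfl
  rw [hI]
  refine ⟨⟨_, ?_, GapFree.initialIdeal_expKer_eq_span_minimal⟩, _,
    GapFree.isReducedGroebnerBasis_reducedBinomials, fun ℋ hℋ => ?_, ?_⟩
  · rintro _ ⟨u, hu, rfl⟩
    exact ⟨u, GapFree.squarefree_of_minimal hG he hu, rfl⟩
  · exact (hℋ.subset_of_isReducedGroebnerBasis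
      GapFree.isReducedGroebnerBasis_reducedBinomials).antisymm
      (GapFree.isReducedGroebnerBasis_reducedBinomials.subset_of_isReducedGroebnerBasis hℋ)
  · intro g hg
    have hirr := GapFree.irreducible_of_mem_reducedBinomials hg
    have hmem := GapFree.isReducedGroebnerBasis_reducedBinomials.subset hg
    obtain ⟨u, v, hu, hv, h, rfl⟩ := hg
    refine ⟨⟨u, v, fun huv => hv (huv ▸ hu.1), rfl⟩, hmem, hirr, ?_⟩
    rintro _ ⟨u', v', hne, rfl⟩ hmem'
    exact GapFree.not_vars_ssubset K hG he hu hv h hne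
      (GapFree.monomial_sub_monomial_mem_expKer.1 hmem')
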